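/- Let $T>0$, $r\neq0$, $v,x_1\in\mathbb R$, $\sigma>0$, $\alpha_1,\alpha_2>0$, and let $W$ be a standard Brownian motion. For $\theta>0$ consider the problem of maximizing $$\mathbb E\Big[-\tfrac1{\alpha_1}e^{-\alpha_1X_1(T)}\Big]-\frac{\theta}{2}\int_0^T\big[\dot P_1(t)-\dot{\bar P}_2(t)\big]^2\,dt,\qquad \bar P_2(t)=\frac{v}{\alpha_2\sigma^2}e^{r(t-T)},$$ over all continuously differentiable (deterministic) decisions $P_1:[0,T]\to\mathbb R$ with $\dot P_1(0)=\frac{rv}{\alpha_2\sigma^2}e^{-rT}$ and $\dot P_1(T)=\frac{rv}{\alpha_2\sigma^2}$, where $X_1$ is the wealth process solving $dX_1(t)=[rX_1(t)+vP_1(t)]\,dt+\sigma P_1(t)\,dW(t)$, $X_1(0)=x_1$. Then for every $\theta>0$ there is exactly one optimal decision $P^*_{1,\theta}$ on $[0,T]$, and, as $\theta\to\infty$, it converges for every $t\in[0,T]$, uniformly in $t$, to $$P^*_{1\infty}(t)=\bar P_2(t)+\frac{2v(\alpha_1^{-1}-\alpha_2^{-1})}{\sigma^2}\cdot\frac{e^{rT}-1}{e^{2rT}-1}.$$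 -/

import Mathlib

open Set Filter Topology MeasureTheory ProbabilityTheory

noncomputable section

namespace Imitation

/-- Left-endpoint Riemann sum, over the uniform partition of `[0, t]` into `n` intervals, of the
deterministic integrand `f` against the process `W`. -/
def itoSum {Ω : Type*} (W : NNReal → Ω → ℝ) (f : ℝ → ℝ) (t : ℝ) (n : ℕ) (ω : Ω) : ℝ :=
  ∑ i ∈ Finset.range n,
    f (i * t / n) *
      (W (Real.toNNReal ((i + 1) * t / n)) ω - W (Real.toNNReal (i * t / n)) ω)

/-- `I` is (a version of) the Itô integral `∫₀ᵗ f(s) dW(s)`, for an integrand `f` that is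
deterministic and continuous on `[0, t]`: the limit in probability of the Riemann sums. -/
def IsItoIntegral {Ω : Type*} [MeasurableSpace Ω] (μ : Measure Ω) (W : NNReal → Ω → ℝ)
    (f : ℝ → ℝ) (t : ℝ) (I : Ω → ℝ) : Prop :=
  TendstoInMeasure μ (itoSum W f t) atTop I

/-- `X` is a wealth process on `[0, T]` for the decision `P`: it has continuous paths, starts at
`x`, and solves `dX(t) = [r X(t) + v P(t)] dt + σ P(t) dW(t)`, written in integral form. -/
structure IsWealthProcess {Ω : Type*} [MeasurableSpace Ω] (μ : Measure Ω) (W : NNReal → Ω → ℝ)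
    (r v σ T x : ℝ) (P : ℝ → ℝ) (X : ℝ → Ω → ℝ) : Prop where
  aemeasurable : ∀ t ∈ Icc 0 T, AEMeasurable (X t) μ
  continuous_paths : ∀ᵐ ω ∂μ, ContinuousOn (fun t => X t ω) (Icc 0 T)
  initial : ∀ᵐ ω ∂μ, X 0 ω = x
  sde : ∃ I : ℝ → Ω → ℝ,
    (∀ t ∈ Icc 0 T, IsItoIntegral μ W (fun s => σ * P s) t (I t)) ∧
    ∀ t ∈ Icc 0 T, ∀ᵐ ω ∂μ,
      X t ω = x + (∫ s in (0 : ℝ)..t, (r * X s ω + v * P s)) + I t ω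

/-- The constant absolute risk aversion utility `φ(x) = -(1/α) exp(-α x)`. -/
def utility (α x : ℝ) : ℝ := -(1 / α) * Real.exp (-α * x)

/-- The rational decision `v / (α σ²) · exp(r (t - T))` of an investor with risk aversion `α`. -/
def rationalDecision (r v σ T α t : ℝ) : ℝ := v / (α * σ ^ 2) * Real.exp (r * (t - T))

/-- The changing rate (time derivative on `[0, T]`, one-sided at the end points) of a decision. -/
def changingRate (T : ℝ) (P : ℝ → ℝ) (t : ℝ) : ℝ := derivWithin P (Icc 0 T) t

/-- The integral disparity `D(f, g) = ½ ∫₀ᵀ (f(t) - g(t))² dt`. -/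
def integralDisparity (T : ℝ) (f g : ℝ → ℝ) : ℝ :=
  1 / 2 * ∫ t in (0 : ℝ)..T, (f t - g t) ^ 2

/-- The objective `𝔼 φ₁(X(T)) - θ D(Ṗ, dP̄₂/dt)`. For the wealth process of a continuous
deterministic decision `X(T)` is Gaussian, so the expectation is that of an integrable variable. -/
def objective {Ω : Type*} [MeasurableSpace Ω] (μ : Measure Ω) (r v σ T α₁ α₂ θ : ℝ)
    (P : ℝ → ℝ) (X : ℝ → Ω → ℝ) : ℝ :=
  (∫ ω, utility α₁ (X T ω) ∂μ) -
    θ * integralDisparity T (changingRate T P)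
      (changingRate T (rationalDecision r v σ T α₂))

/-- The constraints: `P` is a continuously differentiable decision on `[0, T]` whose changing rate
agrees with that of the expert at times `0` and `T`, and `X` is a wealth process for `P`. -/
structure IsFeasible {Ω : Type*} [MeasurableSpace Ω] (μ : Measure Ω) (W : NNReal → Ω → ℝ)
    (r v σ T α₂ x₁ : ℝ) (P : ℝ → ℝ) (X : ℝ → Ω → ℝ) : Prop where
  contDiffOn : ContDiffOn ℝ 1 P (Icc 0 T)
  rate_zero : changingRate T P 0 = r * v / (α₂ * σ ^ 2) * Real.exp (-r * T)
  rate_terminal : changingRate T P T = r * v / (α₂ * σ ^ 2)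
  wealth : IsWealthProcess μ W r v σ T x₁ P X

/-- `P` is an optimal decision: together with a wealth process it is feasible, and it maximizes
the objective among all feasible decisions and their wealth processes. -/
def IsOptimalDecision {Ω : Type*} [MeasurableSpace Ω] (μ : Measure Ω) (W : NNReal → Ω → ℝ)
    (r v σ T α₁ α₂ x₁ θ : ℝ) (P : ℝ → ℝ) : Prop :=
  ∃ X : ℝ → Ω → ℝ, IsFeasible μ W r v σ T α₂ x₁ P X ∧
    ∀ (Q : ℝ → ℝ) (Y : ℝ → Ω → ℝ), IsFeasible μ W r v σ T α₂ x₁ Q Y →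
      objective μ r v σ T α₁ α₂ θ Q Y ≤ objective μ r v σ T α₁ α₂ θ P X

end Imitation

end

open Set Filter Topology MeasureTheory ProbabilityTheory

noncomputable section

namespace Imitation

/-! ### Riemann sums and the Wiener integral of a continuously differentiable integrand -/

/-! Write a decision as the expert's decision plus a deviation `u`, and put `w t = exp (r (T - t))`.
Terminal wealth is Gaussian with mean and variance explicit in `w P`. Since `w` times the expert's
decision is constant, completing the square turns the problem into minimizing the strictly convex
functional `C exp (B / 2 ∫ (w u - κ)²) + θ / 2 ∫ u'²`, with `κ = v (α₁⁻¹ - α₂⁻¹) / σ²` and `B = α₁²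
σ²`. Its Euler-Lagrange equation is `u'' = k w (w u - κ)` with zero Neumann data, which are exactly
the rate constraints. The coefficient `k` depends on `u` through the exponential. For fixed `k` the
problem is linear and solved by shooting (`exists_isNeumannSolution`); a consistent `k` comes from
the intermediate value theorem (`exists_isNeumannSolution_selfConsistent`). The energy identity and
convexity of `exp` then bound the excess of any competitor below by a positive multiple of `∫ (w (g
- u))²`, giving optimality and uniqueness together (`functional_gap`). The consistent `k` is
`O(1/θ)`. Small `k` forces small `u'`, so `u` is nearly constant, and testing the equation against
`1` identifies the constant as the `c` with `∫ w (w c - κ) = 0` (`abs_sub_const_le`). -/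

theorem tendsto_sum_mul_integral {b g : ℝ → ℝ} (hb : Continuous b) (hg : Continuous g) {t : ℝ}
    (ht : 0 ≤ t) (c : ℕ → ℕ → ℝ)
    (hc : ∀ n i : ℕ, c n i ∈ Icc ((i : ℝ) * t / n) (((i : ℝ) + 1) * t / n)) :
    Tendsto (fun n : ℕ => ∑ i ∈ Finset.range n,
        b (c n i) * ∫ s in ((i : ℝ) * t / n)..(((i : ℝ) + 1) * t / n), g s)
      atTop (𝓝 (∫ s in (0 : ℝ)..t, b s * g s)) := by
  obtain ⟨M, hM⟩ := isCompact_Icc.exists_bound_of_continuousOn (s := Icc 0 t) hg.continuousOn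
  have hM0 : 0 ≤ M := (norm_nonneg _).trans (hM 0 ⟨le_rfl, ht⟩)
  have huc := isCompact_Icc.uniformContinuousOn_of_continuous (s := Icc 0 t) hb.continuousOn
  rw [Metric.uniformContinuousOn_iff] at huc
  rw [Metric.tendsto_atTop]
  intro ε hε
  -- The `+ 1` keeps the denominator positive when `M * t = 0` and makes the final bound strict.
  obtain ⟨δ, hδ, hbδ⟩ := huc (ε / (M * t + 1)) (by positivity)
  obtain ⟨N, hN⟩ := exists_nat_gt (t / δ)
  refine ⟨N + 1, fun n hn => ?_⟩
  have hn0 : (0 : ℝ) < n := by exact_mod_cast (by omega : 0 < n)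
  have hnN : t / δ < n := hN.trans (by exact_mod_cast (by omega : N < n))
  have hstep : t / n < δ := by
    rw [div_lt_iff₀ hδ] at hnN
    rw [div_lt_iff₀ hn0]; linarith
  have hbg : ∀ x y : ℝ, IntervalIntegrable (fun s => b s * g s) volume x y :=
    fun x y => (hb.mul hg).intervalIntegrable x y
  have hsum : (∫ s in (0 : ℝ)..t, b s * g s) = ∑ i ∈ Finset.range n,
      ∫ s in ((i : ℝ) * t / n)..(((i : ℝ) + 1) * t / n), b s * g s := by
    have := intervalIntegral.sum_integral_adjacent_intervals (μ := volume)
      (f := fun s => b s * g s) (a := fun i : ℕ => (i : ℝ) * t / n) (n := n)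
      (fun k _ => hbg _ _)
    rw [show (n : ℝ) * t / n = t by field_simp] at this
    simp only [Nat.cast_add, Nat.cast_one, Nat.cast_zero, zero_mul, zero_div] at this
    exact this.symm
  rw [Real.dist_eq, hsum, ← Finset.sum_sub_distrib]
  have hterm : ∀ i ∈ Finset.range n,
      |b (c n i) * (∫ s in ((i : ℝ) * t / n)..(((i : ℝ) + 1) * t / n), g s) -
        ∫ s in ((i : ℝ) * t / n)..(((i : ℝ) + 1) * t / n), b s * g s| ≤
        ε / (M * t + 1) * M * (t / n) := by
    intro i hi
    have hin : (i : ℝ) + 1 ≤ n := by exact_mod_cast Finset.mem_range.1 hi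
    have hle : (i : ℝ) * t / n ≤ ((i : ℝ) + 1) * t / n := by gcongr; linarith
    have hlen : ((i : ℝ) + 1) * t / n - (i : ℝ) * t / n = t / n := by ring
    have h0 : 0 ≤ (i : ℝ) * t / n := by positivity
    have h1 : ((i : ℝ) + 1) * t / n ≤ t := by
      rw [div_le_iff₀ hn0]; nlinarith
    have hcg : IntervalIntegrable (fun s => b (c n i) * g s) volume ((i : ℝ) * t / n)
        (((i : ℝ) + 1) * t / n) := (continuous_const.mul hg).intervalIntegrable _ _
    rw [← intervalIntegral.integral_const_mul, ← intervalIntegral.integral_sub hcg (hbg _ _)]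
    have := intervalIntegral.norm_integral_le_of_norm_le_const (a := (i : ℝ) * t / n)
      (b := ((i : ℝ) + 1) * t / n) (C := ε / (M * t + 1) * M)
      (f := fun s => b (c n i) * g s - b s * g s) ?_
    · rwa [Real.norm_eq_abs, hlen, abs_of_nonneg (by positivity : 0 ≤ t / n)] at this
    · intro s hs
      rw [uIoc_of_le hle] at hs
      have hci := hc n i
      rw [← sub_mul, norm_mul]
      refine mul_le_mul (le_of_lt ?_) (hM s ⟨by linarith [hs.1], by linarith [hs.2]⟩)
        (norm_nonneg _) (by positivity)
      rw [← dist_eq_norm]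
      refine hbδ _ ⟨by linarith [hci.1], by linarith [hci.2]⟩ _
        ⟨by linarith [hs.1], by linarith [hs.2]⟩ ?_
      rw [Real.dist_eq, abs_lt]
      constructor <;> linarith [hs.1, hs.2, hci.1, hci.2]
  calc _ ≤ ∑ i ∈ Finset.range n, ε / (M * t + 1) * M * (t / n) :=
        (Finset.abs_sum_le_sum_abs _ _).trans (Finset.sum_le_sum hterm)
    _ = ε * ((M * t) / (M * t + 1)) := by
        rw [Finset.sum_const, Finset.card_range, nsmul_eq_mul]; field_simp
    _ < ε := by
        have : M * t / (M * t + 1) < 1 := by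
          rw [div_lt_one (by positivity)]; linarith
        nlinarith

/-- Summation by parts: `f(left) Δb = Δ(f b) - b(right) Δf`. The first part telescopes, and `Δf` is
an integral of `f'`, so the rest is a Riemann sum with tags at right endpoints. Only continuity of
`b` is needed, so this applies to Brownian paths. -/
theorem tendsto_stieltjesSum {b f f' : ℝ → ℝ} (hb : Continuous b) (hf' : Continuous f')
    (hf : ∀ s, HasDerivAt f (f' s) s) {t : ℝ} (ht : 0 ≤ t) :
    Tendsto (fun n : ℕ => ∑ i ∈ Finset.range n,
        f ((i : ℝ) * t / n) * (b (((i : ℝ) + 1) * t / n) - b ((i : ℝ) * t / n)))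
      atTop (𝓝 (f t * b t - f 0 * b 0 - ∫ s in (0 : ℝ)..t, f' s * b s)) := by
  have h := tendsto_sum_mul_integral hb hf' ht (fun n i : ℕ => ((i : ℝ) + 1) * t / n)
    (fun n i => ⟨by gcongr; linarith, le_rfl⟩)
  have h2 := h.const_sub (f t * b t - f 0 * b 0)
  simp_rw [mul_comm (b _)] at h2
  refine h2.congr' ?_
  filter_upwards [eventually_gt_atTop 0] with n hn
  have hn0 : (n : ℝ) ≠ 0 := by exact_mod_cast hn.ne'
  have htel := Finset.sum_range_sub
    (fun i : ℕ => f ((i : ℝ) * t / n) * b ((i : ℝ) * t / n)) n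
  rw [show (n : ℝ) * t / n = t by field_simp] at htel
  simp only [Nat.cast_add, Nat.cast_one, Nat.cast_zero, zero_mul, zero_div] at htel
  rw [← htel, ← Finset.sum_sub_distrib]
  refine Finset.sum_congr rfl fun i _ => ?_
  rw [intervalIntegral.integral_eq_sub_of_hasDerivAt (fun s _ => hf s)
    (hf'.intervalIntegrable _ _)]
  ring

/-- The Wiener integral `∫₀ᵗ f dW` of a continuously differentiable integrand `f`, with derivative
`f'`, defined path by path through integration by parts. -/
def wienerIntegral {Ω : Type*} (W : NNReal → Ω → ℝ) (f f' : ℝ → ℝ) (t : ℝ) (ω : Ω) : ℝ :=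
  f t * W (Real.toNNReal t) ω - ∫ s in (0 : ℝ)..t, f' s * W (Real.toNNReal s) ω

section Wiener

variable {Ω : Type*} [MeasurableSpace Ω] {μ : Measure Ω} {W : NNReal → Ω → ℝ}

theorem ae_tendsto_itoSum (hW : IsBrownianReal W μ) {f f' : ℝ → ℝ} (hf' : Continuous f')
    (hf : ∀ s, HasDerivAt f (f' s) s) {t : ℝ} (ht : 0 ≤ t) :
    ∀ᵐ ω ∂μ, Tendsto (fun n => itoSum W f t n ω) atTop (𝓝 (wienerIntegral W f f' t ω)) := by
  filter_upwards [hW.cont, hW.eval_zero_ae_eq_zero] with ω hω h0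
  have := tendsto_stieltjesSum (b := fun s => W (Real.toNNReal s) ω)
    (hω.comp continuous_real_toNNReal) hf' hf ht
  simpa [itoSum, wienerIntegral, h0] using this

theorem aemeasurable_itoSum (hW : IsPreBrownianReal W μ) (f : ℝ → ℝ) (t : ℝ) (n : ℕ) :
    AEMeasurable (itoSum W f t n) μ := by
  unfold itoSum
  exact Finset.aemeasurable_fun_sum _ fun i _ =>
    ((hW.aemeasurable _).sub (hW.aemeasurable _)).const_mul _

theorem aemeasurable_wienerIntegral (hW : IsBrownianReal W μ) {f f' : ℝ → ℝ}
    (hf' : Continuous f') (hf : ∀ s, HasDerivAt f (f' s) s) {t : ℝ} (ht : 0 ≤ t) :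
    AEMeasurable (wienerIntegral W f f' t) μ :=
  aemeasurable_of_tendsto_metrizable_ae atTop
    (fun n => aemeasurable_itoSum hW.toIsPreBrownianReal f t n) (ae_tendsto_itoSum hW hf' hf ht)

theorem isItoIntegral_wienerIntegral (hW : IsBrownianReal W μ) {f f' : ℝ → ℝ}
    (hf' : Continuous f') (hf : ∀ s, HasDerivAt f (f' s) s) {t : ℝ} (ht : 0 ≤ t) :
    IsItoIntegral μ W f t (wienerIntegral W f f' t) := by
  have := hW.isGaussianProcess.isProbabilityMeasure
  exact tendstoInMeasure_of_tendsto_ae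
    (fun n => (aemeasurable_itoSum hW.toIsPreBrownianReal f t n).aestronglyMeasurable)
    (ae_tendsto_itoSum hW hf' hf ht)

/-- A Riemann sum is a combination of independent Gaussian increments, so its characteristic
function is a product. -/
theorem charFun_map_itoSum (hW : IsPreBrownianReal W μ) (f : ℝ → ℝ) {t : ℝ} (ht : 0 ≤ t)
    (n : ℕ) (u : ℝ) :
    charFun (μ.map (itoSum W f t n)) u =
      Complex.exp (-(((∑ i ∈ Finset.range n, f ((i : ℝ) * t / n) ^ 2 * (t / n)) * u ^ 2 / 2 :
        ℝ) : ℂ)) := by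
  have := hW.isGaussianProcess.isProbabilityMeasure
  let τ : Fin (n + 1) → NNReal := fun i => Real.toNNReal ((i : ℕ) * t / n)
  have hτ : Monotone τ := by
    intro i j hij
    have : ((i : ℕ) : ℝ) ≤ (j : ℕ) := by exact_mod_cast hij
    exact Real.toNNReal_mono (by gcongr)
  have hind := hW.hasIndepIncrements n τ hτ
  have hind2 := hind.comp (fun i x => f ((i : ℕ) * t / n) * x) (fun i => by fun_prop)
  have hms : ∀ i : Fin n, AEMeasurable (fun ω => W (τ i.succ) ω - W (τ i.castSucc) ω) μ :=
    fun i => (hW.aemeasurable _).sub (hW.aemeasurable _)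
  have hprod := iIndepFun.charFun_map_fun_sum_eq_prod
    (fun i => (hms i).const_mul (f ((i : ℕ) * t / n))) hind2
  have heq : itoSum W f t n = fun ω => ∑ i : Fin n, f ((i : ℕ) * t / n) *
      (W (τ i.succ) ω - W (τ i.castSucc) ω) := by
    funext ω
    simp [itoSum, Finset.sum_range, τ]
  rw [heq, hprod, Finset.prod_apply]
  have hterm : ∀ i : Fin n, charFun (μ.map (fun ω => f ((i : ℕ) * t / n) *
      (W (τ i.succ) ω - W (τ i.castSucc) ω))) u =
      Complex.exp (-((f ((i : ℕ) * t / n) ^ 2 * (t / n) * u ^ 2 / 2 : ℝ) : ℂ)) := by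
    intro i
    rw [charFun_map_mul_comp (hms i)]
    have hlaw := (hW.hasLaw_sub (τ i.succ) (τ i.castSucc)).map_eq
    rw [show (fun ω => W (τ i.succ) ω - W (τ i.castSucc) ω) = W (τ i.succ) - W (τ i.castSucc)
      from rfl, hlaw, charFun_gaussianReal]
    have hv : (nndist (τ i.succ).1 (τ i.castSucc).1 : ℝ) = t / n := by
      rw [coe_nndist, Real.dist_eq]
      have h1 : (0 : ℝ) ≤ ((i : ℕ) + 1 : ℝ) * t / n := by positivity
      have h2 : (0 : ℝ) ≤ ((i : ℕ) : ℝ) * t / n := by positivity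
      simp only [τ, Fin.val_succ, Fin.val_castSucc, Nat.cast_add, Nat.cast_one, NNReal.val_eq_coe,
        Real.coe_toNNReal _ h1, Real.coe_toNNReal _ h2]
      rw [show ((i : ℕ) + 1 : ℝ) * t / n - (i : ℕ) * t / n = t / n by ring]
      exact abs_of_nonneg (by positivity)
    rw [hv]
    congr 1
    push_cast
    ring
  rw [Finset.prod_congr rfl (fun i _ => hterm i), ← Complex.exp_sum, Finset.sum_range]
  congr 1
  push_cast
  rw [Finset.sum_neg_distrib, Finset.sum_mul, Finset.sum_div]

/-- Almost sure convergence of the Riemann sums carries their characteristic functions to the limit,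
while their variances are Riemann sums of `f ^ 2`. -/
theorem hasLaw_wienerIntegral (hW : IsBrownianReal W μ) {f f' : ℝ → ℝ}
    (hf' : Continuous f') (hf : ∀ s, HasDerivAt f (f' s) s) {t : ℝ} (ht : 0 ≤ t) :
    HasLaw (wienerIntegral W f f' t)
      (gaussianReal 0 (Real.toNNReal (∫ s in (0 : ℝ)..t, f s ^ 2))) μ := by
  have := hW.isGaussianProcess.isProbabilityMeasure
  have hm := aemeasurable_wienerIntegral hW hf' hf ht
  have hms := fun n => aemeasurable_itoSum hW.toIsPreBrownianReal f t n
  have hfc : Continuous f := continuous_iff_continuousAt.2 fun s => (hf s).continuousAt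
  refine ⟨hm, ?_⟩
  have := Measure.isProbabilityMeasure_map (μ := μ) hm
  refine Measure.ext_of_charFun (funext fun u => ?_)
  have hlim : Tendsto (fun n => charFun (μ.map (itoSum W f t n)) u) atTop
      (𝓝 (charFun (μ.map (wienerIntegral W f f' t)) u)) := by
    simp_rw [charFun_apply_real]
    rw [integral_map hm (by fun_prop)]
    simp_rw [fun n => integral_map (hms n) (f := fun x : ℝ => Complex.exp (u * x * Complex.I))
      (by fun_prop)]
    refine tendsto_integral_of_dominated_convergence (fun _ => 1) (fun n => ?_)
      (integrable_const _) (fun n => ?_) ?_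
    · have : Measurable fun x : ℝ => Complex.exp (u * x * Complex.I) := by fun_prop
      exact (this.comp_aemeasurable (hms n)).aestronglyMeasurable
    · refine Eventually.of_forall fun ω => ?_
      rw [← Complex.ofReal_mul, Complex.norm_exp_ofReal_mul_I]
    · filter_upwards [ae_tendsto_itoSum hW hf' hf ht] with ω hω
      have hc : Continuous fun x : ℝ => Complex.exp (u * x * Complex.I) := by fun_prop
      exact (hc.tendsto _).comp hω
  have hv : Tendsto (fun n : ℕ => ∑ i ∈ Finset.range n, f ((i : ℝ) * t / n) ^ 2 * (t / n)) atTop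
      (𝓝 (∫ s in (0 : ℝ)..t, f s ^ 2)) := by
    have h := tendsto_sum_mul_integral (b := fun s => f s ^ 2) (g := fun _ => 1)
      (hfc.pow 2) continuous_const ht (fun n i : ℕ => (i : ℝ) * t / n)
      (fun n i => ⟨le_rfl, by gcongr; linarith⟩)
    simp only [mul_one, intervalIntegral.integral_const, smul_eq_mul] at h
    refine h.congr fun n => Finset.sum_congr rfl fun i _ => ?_
    ring_nf
  refine tendsto_nhds_unique hlim ?_
  simp_rw [charFun_map_itoSum hW.toIsPreBrownianReal f ht]
  have hc : Continuous fun x : ℝ => Complex.exp (-((x * u ^ 2 / 2 : ℝ) : ℂ)) := by fun_prop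
  have := (hc.tendsto _).comp hv
  rw [charFun_gaussianReal, Real.coe_toNNReal _
    (intervalIntegral.integral_nonneg ht fun s _ => sq_nonneg _)]
  convert this using 2
  congr 1
  push_cast
  ring_nf

end Wiener

/-! ### The wealth process of a continuously differentiable decision -/

theorem hasDerivAt_const_add_integral {φ : ℝ → ℝ} (hφ : Continuous φ) (c t : ℝ) :
    HasDerivAt (fun t => c + ∫ s in (0 : ℝ)..t, φ s) (φ t) t :=
  (intervalIntegral.integral_hasDerivAt_right (hφ.intervalIntegrable _ _)
    (hφ.stronglyMeasurableAtFilter _ _) hφ.continuousAt).const_add _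

/-- Extending the one-sided derivative by constants beyond the interval and integrating gives a
decision differentiable on all of `ℝ`, so end points need no separate treatment later. -/
theorem exists_extension_of_contDiffOn {P : ℝ → ℝ} {T : ℝ} (hT : 0 < T)
    (hP : ContDiffOn ℝ 1 P (Icc 0 T)) :
    ∃ p p' : ℝ → ℝ, Continuous p' ∧ (∀ t, HasDerivAt p (p' t) t) ∧ EqOn p P (Icc 0 T) ∧
      EqOn p' (changingRate T P) (Icc 0 T) := by
  have hcd : ContinuousOn (derivWithin P (Icc 0 T)) (Icc 0 T) :=
    hP.continuousOn_derivWithin (uniqueDiffOn_Icc hT) le_rfl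
  let p' : ℝ → ℝ := IccExtend hT.le ((Icc 0 T).domRestrict (derivWithin P (Icc 0 T)))
  have hp' : Continuous p' := (continuousOn_iff_continuous_domRestrict.1 hcd).Icc_extend'
  have hpe : EqOn p' (changingRate T P) (Icc 0 T) := fun t ht => by
    simp [p', IccExtend_of_mem hT.le _ ht, changingRate, Set.domRestrict_apply]
  refine ⟨fun t => P 0 + ∫ s in (0 : ℝ)..t, p' s, p', hp', fun t => ?_, fun t ht => ?_, hpe⟩
  · exact hasDerivAt_const_add_integral hp' _ t
  · have : (∫ s in (0 : ℝ)..t, p' s) = P t - P 0 := by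
      refine intervalIntegral.integral_eq_sub_of_hasDerivAt_of_le ht.1
        (hP.continuousOn.mono (Icc_subset_Icc_right ht.2)) (fun s hs => ?_)
        (hp'.intervalIntegrable _ _)
      have hs' : s ∈ Icc 0 T := ⟨hs.1.le, hs.2.le.trans ht.2⟩
      rw [hpe hs']
      exact ((hP.differentiableOn one_ne_zero) s hs').hasDerivWithinAt.hasDerivAt
        (Icc_mem_nhds hs.1 (hs.2.trans_le ht.2))
    simp [this]

theorem changingRate_eq {P p p' : ℝ → ℝ} {T : ℝ} (hT : 0 < T) (hp : ∀ t, HasDerivAt p (p' t) t)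
    (h : EqOn P p (Icc 0 T)) : EqOn (changingRate T P) p' (Icc 0 T) := fun t ht => by
  unfold changingRate
  rw [derivWithin_congr h (h ht)]
  exact (hp t).hasDerivWithinAt.derivWithin (uniqueDiffOn_Icc hT t ht)

theorem itoSum_congr {Ω : Type*} (W : NNReal → Ω → ℝ) {f g : ℝ → ℝ} {t : ℝ} (ht : 0 ≤ t)
    (h : EqOn f g (Icc 0 t)) : itoSum W f t = itoSum W g t := by
  funext n ω
  refine Finset.sum_congr rfl fun i hi => ?_
  have hin : (i : ℝ) ≤ n := by exact_mod_cast (Finset.mem_range.1 hi).le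
  have hn : (0 : ℝ) < n := by exact_mod_cast (Nat.zero_le i).trans_lt (Finset.mem_range.1 hi)
  rw [h ⟨by positivity, by rw [div_le_iff₀ hn]; nlinarith⟩]

/-- The integral of `exp (r (t - s)) (v p(s) - σ (p'(s) - r p(s)) b(s))` drives the linear
equation obtained by subtracting the martingale part along a path `b`. -/
theorem linear_integral_equation_unique {X b p p' : ℝ → ℝ} {r v σ T x : ℝ} (hT : 0 ≤ T)
    (hX : ContinuousOn X (Icc 0 T)) (hb : Continuous b) (hp' : Continuous p')
    (hp : Continuous p)
    (h : ∀ t ∈ Icc 0 T, X t = x + (∫ s in (0 : ℝ)..t, (r * X s + v * p s)) +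
      (σ * p t * b t - ∫ s in (0 : ℝ)..t, σ * p' s * b s)) :
    X T = Real.exp (r * T) * x + v * (∫ s in (0 : ℝ)..T, Real.exp (r * (T - s)) * p s) +
      (σ * p T * b T -
        ∫ s in (0 : ℝ)..T, σ * (Real.exp (r * (T - s)) * (p' s - r * p s)) * b s) := by
  let Xe : ℝ → ℝ := IccExtend hT ((Icc 0 T).domRestrict X)
  have hXe : Continuous Xe := (continuousOn_iff_continuous_domRestrict.1 hX).Icc_extend'
  have hXX : EqOn Xe X (Icc 0 T) := fun t ht => by simp [Xe, IccExtend_of_mem hT _ ht, Set.domRestrict_apply]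
  -- `φ` is the derivative of `Y = X - σ p b`: the rough part of the path cancels, leaving a linear
  -- differential equation for `Y` with integrating factor `exp (-r s)`.
  let φ : ℝ → ℝ := fun s => r * Xe s + v * p s - σ * p' s * b s
  have hφ : Continuous φ := by fun_prop
  let Y : ℝ → ℝ := fun t => x + ∫ s in (0 : ℝ)..t, φ s
  have hY : ∀ t, HasDerivAt Y (φ t) t := hasDerivAt_const_add_integral hφ x
  have hXY : ∀ t ∈ Icc 0 T, X t = Y t + σ * p t * b t := by
    intro t ht
    have hc1 : Continuous fun s => r * Xe s + v * p s := by fun_prop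
    have hc2 : Continuous fun s => σ * p' s * b s := by fun_prop
    have e1 : (∫ s in (0 : ℝ)..t, (r * X s + v * p s)) =
        ∫ s in (0 : ℝ)..t, (r * Xe s + v * p s) := by
      refine intervalIntegral.integral_congr fun s hs => ?_
      rw [uIcc_of_le ht.1] at hs
      simp only [hXX ⟨hs.1, hs.2.trans ht.2⟩]
    rw [h t ht, e1]
    simp only [Y, φ]
    rw [intervalIntegral.integral_sub (hc1.intervalIntegrable _ _) (hc2.intervalIntegrable _ _)]
    ring
  have hYc : Continuous Y := continuous_iff_continuousAt.2 fun s => (hY s).continuousAt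
  have hint : (∫ s in (0 : ℝ)..T, Real.exp (-r * s) * (φ s - r * Y s)) =
      Real.exp (-r * T) * Y T - Real.exp (-r * 0) * Y 0 := by
    refine intervalIntegral.integral_eq_sub_of_hasDerivAt
      (f := fun s => Real.exp (-r * s) * Y s) (fun s _ => ?_)
      ((by fun_prop : Continuous fun s => Real.exp (-r * s) *
        (φ s - r * Y s)).intervalIntegrable _ _)
    have h1 : HasDerivAt (fun s : ℝ => Real.exp (-r * s)) (Real.exp (-r * s) * (-r * 1)) s :=
      ((hasDerivAt_id s).const_mul (-r)).exp
    exact (h1.mul (hY s)).congr_deriv (by ring)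
  have hint2 : (∫ s in (0 : ℝ)..T, Real.exp (-r * s) * (φ s - r * Y s)) =
      ∫ s in (0 : ℝ)..T, Real.exp (-r * T) * (v * (Real.exp (r * (T - s)) * p s) -
        σ * (Real.exp (r * (T - s)) * (p' s - r * p s)) * b s) := by
    refine intervalIntegral.integral_congr fun s hs => ?_
    rw [uIcc_of_le hT] at hs
    have he : Real.exp (-r * s) = Real.exp (-r * T) * Real.exp (r * (T - s)) := by
      rw [← Real.exp_add]; ring_nf
    simp only [φ, hXX hs, hXY s hs, he]
    ring
  have hc3 : Continuous fun s => v * (Real.exp (r * (T - s)) * p s) := by fun_prop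
  have hc4 : Continuous fun s => σ * (Real.exp (r * (T - s)) * (p' s - r * p s)) * b s := by
    fun_prop
  rw [hint2, intervalIntegral.integral_const_mul, intervalIntegral.integral_sub
    (hc3.intervalIntegrable _ _) (hc4.intervalIntegrable _ _),
    intervalIntegral.integral_const_mul] at hint
  have hY0 : Y 0 = x := by simp [Y]
  rw [hY0] at hint
  have hexp : Real.exp (r * T) * Real.exp (-r * T) = 1 := by
    rw [← Real.exp_add]; simp
  have key := congrArg (fun z => Real.exp (r * T) * z) hint
  simp only [mul_zero, Real.exp_zero, one_mul, mul_sub, ← mul_assoc, hexp] at key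
  rw [hXY T ⟨hT, le_rfl⟩]
  simp only [mul_sub, ← mul_assoc] at key ⊢
  linarith

/-- Converse of the preceding computation: `exp (r t) * Z t` is the differentiable part of the
closed formula, and differentiating it recovers the integral equation. -/
theorem linear_integral_equation_solution {X b p p' : ℝ → ℝ} {r v σ x : ℝ}
    (hb : Continuous b) (hp' : Continuous p') (hp : Continuous p)
    (h : ∀ t, X t = Real.exp (r * t) * x +
      v * (∫ s in (0 : ℝ)..t, Real.exp (r * (t - s)) * p s) +
      (σ * p t * b t -
        ∫ s in (0 : ℝ)..t, σ * (Real.exp (r * (t - s)) * (p' s - r * p s)) * b s)) :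
    Continuous X ∧ ∀ t, X t = x + (∫ s in (0 : ℝ)..t, (r * X s + v * p s)) +
      (σ * p t * b t - ∫ s in (0 : ℝ)..t, σ * p' s * b s) := by
  let ψ : ℝ → ℝ := fun s => v * p s - σ * (p' s - r * p s) * b s
  let Z : ℝ → ℝ := fun t => x + ∫ s in (0 : ℝ)..t, Real.exp (-r * s) * ψ s
  have hψ : Continuous ψ := by fun_prop
  have hψ2 : Continuous fun s => Real.exp (-r * s) * ψ s := by fun_prop
  have hZ : ∀ t, HasDerivAt Z (Real.exp (-r * t) * ψ t) t := hasDerivAt_const_add_integral hψ2 x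
  have hZc : Continuous Z := continuous_iff_continuousAt.2 fun s => (hZ s).continuousAt
  have hXZ : ∀ t, X t = Real.exp (r * t) * Z t + σ * p t * b t := by
    intro t
    have hc3 : Continuous fun s => v * (Real.exp (r * (t - s)) * p s) := by fun_prop
    have hc4 : Continuous fun s => σ * (Real.exp (r * (t - s)) * (p' s - r * p s)) * b s := by
      fun_prop
    rw [h t]
    simp only [Z]
    rw [mul_add, ← intervalIntegral.integral_const_mul, ← intervalIntegral.integral_const_mul]
    have e : (∫ s in (0 : ℝ)..t, Real.exp (r * t) * (Real.exp (-r * s) * ψ s)) =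
        ∫ s in (0 : ℝ)..t, (v * (Real.exp (r * (t - s)) * p s) -
          σ * (Real.exp (r * (t - s)) * (p' s - r * p s)) * b s) := by
      refine intervalIntegral.integral_congr fun s _ => ?_
      have he : Real.exp (r * (t - s)) = Real.exp (r * t) * Real.exp (-r * s) := by
        rw [← Real.exp_add]; ring_nf
      simp only [ψ, he]
      ring
    rw [e, intervalIntegral.integral_sub (hc3.intervalIntegrable _ _)
      (hc4.intervalIntegrable _ _)]
    ring
  have hXc : Continuous X := by
    rw [show X = fun t => Real.exp (r * t) * Z t + σ * p t * b t from funext hXZ]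
    fun_prop
  refine ⟨hXc, fun t => ?_⟩
  have hc1 : Continuous fun s => r * X s + v * p s := by fun_prop
  have hc2 : Continuous fun s => σ * p' s * b s := by fun_prop
  have hint : (∫ s in (0 : ℝ)..t, ((r * X s + v * p s) - σ * p' s * b s)) =
      Real.exp (r * t) * Z t - Real.exp (r * 0) * Z 0 := by
    refine intervalIntegral.integral_eq_sub_of_hasDerivAt
      (f := fun s => Real.exp (r * s) * Z s) (fun s _ => ?_)
      ((hc1.sub hc2).intervalIntegrable _ _)
    have h1 : HasDerivAt (fun s : ℝ => Real.exp (r * s)) (Real.exp (r * s) * (r * 1)) s :=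
      ((hasDerivAt_id s).const_mul r).exp
    refine (h1.mul (hZ s)).congr_deriv ?_
    have hexp : Real.exp (r * s) * Real.exp (-r * s) = 1 := by
      rw [← Real.exp_add]; simp
    rw [← mul_assoc (Real.exp (r * s)) (Real.exp (-r * s)), hexp, hXZ s]
    simp only [ψ]
    ring
  rw [intervalIntegral.integral_sub (hc1.intervalIntegrable _ _)
    (hc2.intervalIntegrable _ _)] at hint
  have hZ0 : Z 0 = x := by simp [Z]
  rw [hZ0, mul_zero, Real.exp_zero, one_mul] at hint
  rw [hXZ t]
  linarith

/-- The discounted wealth formula for a continuously differentiable decision `p`. -/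
def wealth {Ω : Type*} (W : NNReal → Ω → ℝ) (r v σ x : ℝ) (p p' : ℝ → ℝ) (t : ℝ) (ω : Ω) : ℝ :=
  Real.exp (r * t) * x + v * (∫ s in (0 : ℝ)..t, Real.exp (r * (t - s)) * p s) +
    wienerIntegral W (fun s => σ * (Real.exp (r * (t - s)) * p s))
      (fun s => σ * (Real.exp (r * (t - s)) * (p' s - r * p s))) t ω

theorem hasDerivAt_discounted {p p' : ℝ → ℝ} (hp : ∀ t, HasDerivAt p (p' t) t) (r σ t s : ℝ) :
    HasDerivAt (fun s => σ * (Real.exp (r * (t - s)) * p s))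
      (σ * (Real.exp (r * (t - s)) * (p' s - r * p s))) s := by
  have h1 : HasDerivAt (fun s : ℝ => Real.exp (r * (t - s)))
      (Real.exp (r * (t - s)) * (r * (-1))) s :=
    (((hasDerivAt_id s).const_sub t).const_mul r).exp
  exact ((h1.mul (hp s)).const_mul σ).congr_deriv (by ring)

section Wealth

variable {Ω : Type*} [MeasurableSpace Ω] {μ : Measure Ω} {W : NNReal → Ω → ℝ}
  {r v σ T x : ℝ} {P p p' : ℝ → ℝ}

theorem isWealthProcess_wealth (hW : IsBrownianReal W μ) (hp' : Continuous p')
    (hp : ∀ t, HasDerivAt p (p' t) t) (h : EqOn P p (Icc 0 T)) :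
    IsWealthProcess μ W r v σ T x P (wealth W r v σ x p p') := by
  have hpc : Continuous p := continuous_iff_continuousAt.2 fun s => (hp s).continuousAt
  have hpath : ∀ ω, Continuous (fun t => W t ω) →
      Continuous (fun t => wealth W r v σ x p p' t ω) ∧
      ∀ t, wealth W r v σ x p p' t ω =
        x + (∫ s in (0 : ℝ)..t, (r * wealth W r v σ x p p' s ω + v * p s)) +
        wienerIntegral W (fun s => σ * p s) (fun s => σ * p' s) t ω := by
    intro ω hω
    refine linear_integral_equation_solution (b := fun s => W (Real.toNNReal s) ω)
      (hω.comp continuous_real_toNNReal) hp' hpc fun t => ?_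
    simp [wealth, wienerIntegral]
  refine ⟨fun t ht => ?_, ?_, ?_, fun t => wienerIntegral W (fun s => σ * p s)
    (fun s => σ * p' s) t, fun t ht => ?_, fun t ht => ?_⟩
  · exact (aemeasurable_wienerIntegral hW (by fun_prop)
      (hasDerivAt_discounted hp r σ t) ht.1).const_add _
  · filter_upwards [hW.cont] with ω hω using (hpath ω hω).1.continuousOn
  · filter_upwards [hW.eval_zero_ae_eq_zero] with ω hω
    simp [wealth, wienerIntegral, hω]
  · have h1 := isItoIntegral_wienerIntegral hW (f := fun s => σ * p s) (f' := fun s => σ * p' s)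
      (by fun_prop) (fun s => (hp s).const_mul σ) ht.1
    unfold IsItoIntegral at h1 ⊢
    rwa [itoSum_congr W (g := fun s => σ * p s) ht.1
      fun s hs => by simp only [h ⟨hs.1, hs.2.trans ht.2⟩]]
  · filter_upwards [hW.cont] with ω hω
    rw [(hpath ω hω).2 t]
    congr 2
    refine intervalIntegral.integral_congr fun s hs => ?_
    rw [uIcc_of_le ht.1] at hs
    simp only [h ⟨hs.1, hs.2.trans ht.2⟩]

/-- Limits in probability are almost everywhere unique, so the Itô integral may be taken to be the
pathwise one; the equation can then be solved path by path. -/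
theorem IsWealthProcess.ae_eq_wealth {X : ℝ → Ω → ℝ} (hW : IsBrownianReal W μ) (hT : 0 < T)
    (hp' : Continuous p') (hp : ∀ t, HasDerivAt p (p' t) t) (h : EqOn P p (Icc 0 T))
    (hX : IsWealthProcess μ W r v σ T x P X) :
    ∀ᵐ ω ∂μ, X T ω = wealth W r v σ x p p' T ω := by
  have hpc : Continuous p := continuous_iff_continuousAt.2 fun s => (hp s).continuousAt
  obtain ⟨I, hI, hsde⟩ := hX.sde
  have hI' : ∀ t ∈ Icc 0 T, I t =ᵐ[μ]
      wienerIntegral W (fun s => σ * p s) (fun s => σ * p' s) t := by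
    intro t ht
    have h1 := isItoIntegral_wienerIntegral hW (f := fun s => σ * p s) (f' := fun s => σ * p' s)
      (by fun_prop) (fun s => (hp s).const_mul σ) ht.1
    have h2 := hI t ht
    unfold IsItoIntegral at h1 h2
    rw [itoSum_congr W (g := fun s => σ * p s) ht.1
      fun s hs => by simp only [h ⟨hs.1, hs.2.trans ht.2⟩]] at h2
    exact tendstoInMeasure_ae_unique h2 h1
  -- The equation holds off a null set depending on `t`. A countable dense set of times gives one
  -- null set, and path continuity restores all times.
  obtain ⟨D, hDc, hDd⟩ := TopologicalSpace.exists_countable_dense (Icc (0 : ℝ) T)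
  have hall : ∀ᵐ ω ∂μ, ∀ q ∈ D, X q ω = x + (∫ s in (0 : ℝ)..q, (r * X s ω + v * P s)) +
      wienerIntegral W (fun s => σ * p s) (fun s => σ * p' s) q ω := by
    rw [ae_ball_iff hDc]
    intro q _
    filter_upwards [hsde q q.2, hI' q q.2] with ω h1 h2
    rw [h1, h2]
  filter_upwards [hall, hX.continuous_paths, hW.cont] with ω h1 h2 h3
  have hWc : Continuous fun s => W (Real.toNNReal s) ω := h3.comp continuous_real_toNNReal
  let Xe : ℝ → ℝ := IccExtend hT.le ((Icc 0 T).domRestrict fun t => X t ω)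
  have hXe : Continuous Xe := (continuousOn_iff_continuous_domRestrict.1 h2).Icc_extend'
  have hXX : EqOn Xe (fun t => X t ω) (Icc 0 T) :=
    fun t ht => by simp [Xe, IccExtend_of_mem hT.le _ ht, Set.domRestrict_apply]
  have hcont1 : Continuous fun t => x + (∫ s in (0 : ℝ)..t, (r * Xe s + v * p s)) +
      (σ * p t * W (Real.toNNReal t) ω - ∫ s in (0 : ℝ)..t, σ * p' s * W (Real.toNNReal s) ω) := by
    have hc1 : Continuous fun s => r * Xe s + v * p s := by fun_prop
    have hc2 : Continuous fun s => σ * p' s * W (Real.toNNReal s) ω := by fun_prop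
    have i1 := intervalIntegral.continuous_primitive (μ := volume)
      (fun a b => hc1.intervalIntegrable a b) 0
    have i2 := intervalIntegral.continuous_primitive (μ := volume)
      (fun a b => hc2.intervalIntegrable a b) 0
    fun_prop
  have hcongr : ∀ t ∈ Icc 0 T, ∀ g : ℝ → ℝ, EqOn g p (Icc 0 T) →
      (∫ s in (0 : ℝ)..t, (r * X s ω + v * g s)) = ∫ s in (0 : ℝ)..t, (r * Xe s + v * p s) := by
    intro t ht g hg
    refine intervalIntegral.integral_congr fun s hs => ?_
    rw [uIcc_of_le ht.1] at hs
    have hs' : s ∈ Icc 0 T := ⟨hs.1, hs.2.trans ht.2⟩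
    simp only [hg hs', hXX hs']
  have hEq : (fun q : Icc (0 : ℝ) T => Xe q) = fun q : Icc (0 : ℝ) T =>
      x + (∫ s in (0 : ℝ)..q, (r * Xe s + v * p s)) +
      (σ * p q * W (Real.toNNReal q) ω - ∫ s in (0 : ℝ)..q, σ * p' s * W (Real.toNNReal s) ω) := by
    refine Continuous.ext_on hDd (hXe.comp continuous_subtype_val)
      (hcont1.comp continuous_subtype_val) fun q hq => ?_
    have := h1 q hq
    simp only [wienerIntegral] at this
    rw [← hcongr q q.2 P h, ← this]
    exact hXX q.2
  have := linear_integral_equation_unique (X := fun t => X t ω)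
    (b := fun s => W (Real.toNNReal s) ω) (p := p) (p' := p') (r := r) (v := v) (σ := σ) (x := x)
    hT.le h2 hWc hp' hpc fun t ht => by
      rw [hcongr t ht p fun _ _ => rfl]
      refine (hXX ht).symm.trans ?_
      exact congrFun hEq ⟨t, ht⟩
  simpa [wealth, wienerIntegral] using this

/-- This is the Gaussian moment generating function at `-α`. -/
theorem integral_utility_wealth (hW : IsBrownianReal W μ) (hT : 0 < T)
    (hp' : Continuous p') (hp : ∀ t, HasDerivAt p (p' t) t) (α : ℝ) :
    ∫ ω, utility α (wealth W r v σ x p p' T ω) ∂μ =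
      -(1 / α) * Real.exp (-α * (Real.exp (r * T) * x +
        v * ∫ s in (0 : ℝ)..T, Real.exp (r * (T - s)) * p s) +
        α ^ 2 / 2 * ∫ s in (0 : ℝ)..T, (σ * (Real.exp (r * (T - s)) * p s)) ^ 2) := by
  have hpc : Continuous p := continuous_iff_continuousAt.2 fun s => (hp s).continuousAt
  have hlaw := hasLaw_wienerIntegral hW (f := fun s => σ * (Real.exp (r * (T - s)) * p s))
    (by fun_prop : Continuous fun s => σ * (Real.exp (r * (T - s)) * (p' s - r * p s)))
    (hasDerivAt_discounted hp r σ T) hT.le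
  have hmgf := mgf_gaussianReal hlaw.map_eq (-α)
  rw [Real.coe_toNNReal _ (intervalIntegral.integral_nonneg hT.le fun s _ => sq_nonneg _)] at hmgf
  simp only [mgf] at hmgf
  simp only [utility, wealth, mul_add (-α) (_ + _) (wienerIntegral _ _ _ _ _), Real.exp_add (-α * _)]
  rw [integral_const_mul, integral_const_mul, hmgf, ← Real.exp_add, ← Real.exp_add]
  congr 2
  ring

end Wealth

/-! ### Linear second order equations on a compact interval -/

/-- Clamping the unknowns to `[-R, R]` makes the vector field bounded as well as Lipschitz, so
Picard-Lindelöf covers the whole interval at once. -/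
theorem exists_solution_truncated_system {a c : ℝ → ℝ} (ha : Continuous a) (hc : Continuous c)
    {T : ℝ} (hT : 0 < T) (x₀ : ℝ × ℝ) {R : ℝ} (hR : 0 ≤ R) :
    ∃ x : ℝ → ℝ × ℝ, x 0 = x₀ ∧ ∀ t ∈ Icc 0 T, HasDerivWithinAt x
      ((projIcc (-R) R (by linarith) (x t).2 : ℝ),
        a t * (projIcc (-R) R (by linarith) (x t).1 : ℝ) + c t) (Icc 0 T) t := by
  have hRR : -R ≤ R := by linarith
  obtain ⟨A, hA⟩ := isCompact_Icc.exists_bound_of_continuousOn (s := Icc 0 T) ha.continuousOn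
  obtain ⟨C, hC⟩ := isCompact_Icc.exists_bound_of_continuousOn (s := Icc 0 T) hc.continuousOn
  have hA0 : 0 ≤ A := (norm_nonneg _).trans (hA 0 ⟨le_rfl, hT.le⟩)
  have hC0 : 0 ≤ C := (norm_nonneg _).trans (hC 0 ⟨le_rfl, hT.le⟩)
  have hcl : ∀ x : ℝ, |(projIcc (-R) R hRR x : ℝ)| ≤ R := fun x =>
    abs_le.2 (projIcc (-R) R hRR x).2
  have hlip : ∀ x y : ℝ, |(projIcc (-R) R hRR x : ℝ) - projIcc (-R) R hRR y| ≤ |x - y| := by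
    intro x y
    have := (LipschitzWith.projIcc hRR).dist_le_mul x y
    simpa [Subtype.dist_eq, Real.dist_eq] using this
  let f : ℝ → ℝ × ℝ → ℝ × ℝ := fun t x =>
    ((projIcc (-R) R hRR x.2 : ℝ), a t * (projIcc (-R) R hRR x.1 : ℝ) + c t)
  let K : NNReal := ⟨1 + A, by positivity⟩
  let L : NNReal := ⟨R + (A * R + C), by positivity⟩
  -- Speed bound times duration: solutions cannot leave this ball before time `T`.
  let rad : NNReal := ⟨(R + (A * R + C)) * T, by positivity⟩
  have hPL : IsPicardLindelof f (tmin := 0) (tmax := T) ⟨0, le_rfl, hT.le⟩ x₀ rad 0 L K := by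
    refine ⟨fun t ht => ?_, fun x _ => ?_, fun t ht x _ => ?_, ?_⟩
    · refine LipschitzWith.lipschitzOnWith (LipschitzWith.of_dist_le_mul fun x y => ?_)
      have h1 : |x.1 - y.1| ≤ dist x y := by
        rw [← Real.dist_eq, Prod.dist_eq]; exact le_max_left _ _
      have h2 : |x.2 - y.2| ≤ dist x y := by
        rw [← Real.dist_eq, Prod.dist_eq]; exact le_max_right _ _
      have hd : 0 ≤ dist x y := dist_nonneg
      change dist (f t x) (f t y) ≤ (1 + A) * dist x y
      rw [Prod.dist_eq, Real.dist_eq, Real.dist_eq]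
      refine max_le ?_ ?_
      · have := hlip x.2 y.2
        simp only [f]
        nlinarith
      · simp only [f]
        rw [add_sub_add_right_eq_sub, ← mul_sub, abs_mul]
        have h3 := mul_le_mul (hA t ht) ((hlip x.1 y.1).trans h1) (abs_nonneg _) hA0
        rw [Real.norm_eq_abs] at h3
        nlinarith
    · simp only [f]
      fun_prop
    · change ‖f t x‖ ≤ R + (A * R + C)
      rw [Prod.norm_def]
      have hAR : 0 ≤ A * R := by positivity
      refine max_le ?_ ?_
      · have := hcl x.2
        simp only [f, Real.norm_eq_abs]
        linarith
      · simp only [f]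
        refine (norm_add_le _ _).trans ?_
        rw [norm_mul]
        have h3 := mul_le_mul (hA t ht) (hcl x.1) (abs_nonneg _) hA0
        have h4 := hC t ht
        simp only [Real.norm_eq_abs] at h3 h4 ⊢
        linarith
    · change (R + (A * R + C)) * max (T - 0) (0 - 0) ≤ (R + (A * R + C)) * T - 0
      rw [sub_zero, sub_zero, sub_zero, max_eq_left hT.le]
  exact hPL.exists_eq_forall_mem_Icc_hasDerivWithinAt₀

theorem abs_projIcc_le_abs {R : ℝ} (hR : -R ≤ R) (x : ℝ) : |(projIcc (-R) R hR x : ℝ)| ≤ |x| := by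
  have := (LipschitzWith.projIcc hR).dist_le_mul x 0
  have h0 : (projIcc (-R) R hR 0 : ℝ) = 0 := by
    rw [projIcc_of_mem hR ⟨by linarith, by linarith⟩]
  simpa [Subtype.dist_eq, Real.dist_eq, h0] using this

/-- Clamping does not increase absolute values, so the truncated solution obeys a Grönwall bound
independent of the truncation level. Truncating at that very bound means the clamp never acts. -/
theorem exists_solution_linear_system {a c : ℝ → ℝ} (ha : Continuous a) (hc : Continuous c)
    {T : ℝ} (hT : 0 < T) (x₀ : ℝ × ℝ) :
    ∃ x : ℝ → ℝ × ℝ, x 0 = x₀ ∧ ∀ t ∈ Icc 0 T, HasDerivWithinAt x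
      ((x t).2, a t * (x t).1 + c t) (Icc 0 T) t := by
  obtain ⟨A, hA⟩ := isCompact_Icc.exists_bound_of_continuousOn (s := Icc 0 T) ha.continuousOn
  obtain ⟨C, hC⟩ := isCompact_Icc.exists_bound_of_continuousOn (s := Icc 0 T) hc.continuousOn
  have hA0 : 0 ≤ A := (norm_nonneg _).trans (hA 0 ⟨le_rfl, hT.le⟩)
  have hC0 : 0 ≤ C := (norm_nonneg _).trans (hC 0 ⟨le_rfl, hT.le⟩)
  set R := gronwallBound ‖x₀‖ (1 + A) C T with hRdef
  have hmono := gronwallBound_mono (norm_nonneg x₀) hC0 (by positivity : 0 ≤ 1 + A)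
  have hR : 0 ≤ R := by
    have := hmono hT.le
    rw [gronwallBound_x0] at this
    exact (norm_nonneg _).trans this
  obtain ⟨x, hx0, hx⟩ := exists_solution_truncated_system ha hc hT x₀ hR
  have hbound : ∀ t ∈ Icc 0 T, ‖x t‖ ≤ R := by
    intro t ht
    have := norm_le_gronwallBound_of_norm_deriv_right_le (K := 1 + A) (ε := C)
      (fun t ht => (hx t ht).continuousWithinAt)
      (fun t ht => (hx t ⟨ht.1, ht.2.le⟩).mono_of_mem_nhdsWithin (Icc_mem_nhdsGE_of_mem ht))
      (le_of_eq (congrArg norm hx0)) (fun t ht => ?_) t ht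
    · rw [sub_zero] at this
      exact this.trans (hmono ht.2)
    · have h1 : |(x t).1| ≤ ‖x t‖ := norm_fst_le (x t)
      have h2 : |(x t).2| ≤ ‖x t‖ := norm_snd_le (x t)
      have hn : 0 ≤ ‖x t‖ := norm_nonneg _
      have hAn : 0 ≤ A * ‖x t‖ := by positivity
      rw [Prod.norm_def]
      refine max_le ?_ ?_
      · rw [Real.norm_eq_abs]
        linarith [abs_projIcc_le_abs (by linarith : -R ≤ R) (x t).2]
      · refine (norm_add_le _ _).trans ?_
        rw [norm_mul]
        have h3 := mul_le_mul (hA t ⟨ht.1, ht.2.le⟩)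
          ((abs_projIcc_le_abs (by linarith : -R ≤ R) (x t).1).trans h1) (abs_nonneg _) hA0
        have h4 := hC t ⟨ht.1, ht.2.le⟩
        simp only [Real.norm_eq_abs] at h3 h4 ⊢
        linarith
  refine ⟨x, hx0, fun t ht => ?_⟩
  have h1 := abs_le.1 ((norm_fst_le (x t)).trans (hbound t ht))
  have h2 := abs_le.1 ((norm_snd_le (x t)).trans (hbound t ht))
  have := hx t ht
  rwa [projIcc_of_mem _ h1, projIcc_of_mem _ h2] at this

theorem exists_solution_second_order {a c : ℝ → ℝ} (ha : Continuous a) (hc : Continuous c)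
    {T : ℝ} (hT : 0 < T) (u₀ : ℝ) :
    ∃ u q φ : ℝ → ℝ, (∀ t, HasDerivAt u (q t) t) ∧ (∀ t, HasDerivAt q (φ t) t) ∧ Continuous φ ∧
      (∀ t ∈ Icc 0 T, φ t = a t * u t + c t) ∧ u 0 = u₀ ∧ q 0 = 0 := by
  obtain ⟨x, hx0, hx⟩ := exists_solution_linear_system ha hc hT (u₀, 0)
  have hxc : ContinuousOn x (Icc 0 T) := fun t ht => (hx t ht).continuousWithinAt
  let xe : ℝ → ℝ × ℝ := IccExtend hT.le ((Icc 0 T).domRestrict x)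
  have hxe : Continuous xe := (continuousOn_iff_continuous_domRestrict.1 hxc).Icc_extend'
  have hxx : EqOn xe x (Icc 0 T) := fun t ht => by
    simp [xe, IccExtend_of_mem hT.le _ ht, Set.domRestrict_apply]
  let φ : ℝ → ℝ := fun t => a t * (xe t).1 + c t
  have hφ : Continuous φ := by fun_prop
  let q : ℝ → ℝ := fun t => 0 + ∫ s in (0 : ℝ)..t, φ s
  have hq : ∀ t, HasDerivAt q (φ t) t := hasDerivAt_const_add_integral hφ 0
  have hqc : Continuous q := continuous_iff_continuousAt.2 fun s => (hq s).continuousAt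
  let u : ℝ → ℝ := fun t => u₀ + ∫ s in (0 : ℝ)..t, q s
  have hu : ∀ t, HasDerivAt u (q t) t := hasDerivAt_const_add_integral hqc u₀
  have hIoo : ∀ t ∈ Icc 0 T, ∀ s ∈ Ioo 0 t, HasDerivAt x ((x s).2, φ s) s := by
    intro t ht s hs
    have hs' : s ∈ Icc 0 T := ⟨hs.1.le, hs.2.le.trans ht.2⟩
    have := (hx s hs').hasDerivAt (Icc_mem_nhds hs.1 (hs.2.trans_le ht.2))
    simpa only [φ, hxx hs'] using this
  have hq2 : ∀ t ∈ Icc 0 T, q t = (x t).2 := by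
    intro t ht
    have : (∫ s in (0 : ℝ)..t, φ s) = (x t).2 - (x 0).2 :=
      intervalIntegral.integral_eq_sub_of_hasDerivAt_of_le ht.1
        (continuous_snd.comp_continuousOn (hxc.mono (Icc_subset_Icc_right ht.2)))
        (fun s hs => (hIoo t ht s hs).snd) (hφ.intervalIntegrable _ _)
    simp only [q, this, hx0]
    ring
  have hu1 : ∀ t ∈ Icc 0 T, u t = (x t).1 := by
    intro t ht
    have : (∫ s in (0 : ℝ)..t, q s) = (x t).1 - (x 0).1 :=
      intervalIntegral.integral_eq_sub_of_hasDerivAt_of_le ht.1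
        (continuous_fst.comp_continuousOn (hxc.mono (Icc_subset_Icc_right ht.2)))
        (fun s hs => by
          rw [hq2 s ⟨hs.1.le, hs.2.le.trans ht.2⟩]
          exact (hIoo t ht s hs).fst) (hqc.intervalIntegrable _ _)
    simp only [u, this, hx0]
    ring
  refine ⟨u, q, φ, hu, hq, hφ, fun t ht => ?_, by simp [u], by simp [q]⟩
  simp only [φ, hxx ht, hu1 t ht]

/-- Cauchy-Schwarz, from the discriminant of `x ↦ ∫ (x f + g)²`. -/
theorem sq_integral_mul_le {f g : ℝ → ℝ} (hf : Continuous f) (hg : Continuous g) {T : ℝ}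
    (hT : 0 ≤ T) : (∫ t in (0 : ℝ)..T, f t * g t) ^ 2 ≤
      (∫ t in (0 : ℝ)..T, f t ^ 2) * ∫ t in (0 : ℝ)..T, g t ^ 2 := by
  have h : ∀ x : ℝ, 0 ≤ (∫ t in (0 : ℝ)..T, f t ^ 2) * (x * x) +
      (2 * ∫ t in (0 : ℝ)..T, f t * g t) * x + ∫ t in (0 : ℝ)..T, g t ^ 2 := by
    intro x
    have h0 : 0 ≤ ∫ t in (0 : ℝ)..T, (x * f t + g t) ^ 2 :=
      intervalIntegral.integral_nonneg hT fun t _ => sq_nonneg _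
    have e1 : (∫ t in (0 : ℝ)..T, (x * f t + g t) ^ 2) = ∫ t in (0 : ℝ)..T,
        ((x * x) * f t ^ 2 + (2 * x) * (f t * g t) + g t ^ 2) :=
      intervalIntegral.integral_congr fun t _ => by ring
    have i1 : IntervalIntegrable (fun t => (x * x) * f t ^ 2) volume 0 T :=
      (by fun_prop : Continuous fun t => (x * x) * f t ^ 2).intervalIntegrable _ _
    have i2 : IntervalIntegrable (fun t => (2 * x) * (f t * g t)) volume 0 T :=
      (by fun_prop : Continuous fun t => (2 * x) * (f t * g t)).intervalIntegrable _ _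
    have i3 : IntervalIntegrable (fun t => g t ^ 2) volume 0 T :=
      (hg.pow 2).intervalIntegrable _ _
    rw [e1, intervalIntegral.integral_add (i1.add i2) i3, intervalIntegral.integral_add i1 i2,
      intervalIntegral.integral_const_mul, intervalIntegral.integral_const_mul] at h0
    linarith
  have := discrim_le_zero h
  rw [discrim] at this
  linarith

/-! ### The Neumann problem -/

/-- `u` solves `u'' = k w (w u - κ)` on `[0, T]` with `u'(0) = u'(T) = 0`; `q` and `φ` are the
first two derivatives of `u`. -/
structure IsNeumannSolution (w : ℝ → ℝ) (κ k T : ℝ) (u q φ : ℝ → ℝ) : Prop where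
  deriv_u : ∀ t, HasDerivAt u (q t) t
  deriv_q : ∀ t, HasDerivAt q (φ t) t
  cont : Continuous φ
  eqn : ∀ t ∈ Icc 0 T, φ t = k * (w t * (w t * u t - κ))
  left : q 0 = 0
  right : q T = 0

theorem integral_weak_form {q φ e e' : ℝ → ℝ} {T : ℝ}
    (hq : ∀ t, HasDerivAt q (φ t) t) (hφ : Continuous φ)
    (he : ∀ t, HasDerivAt e (e' t) t) (he' : Continuous e') :
    ∫ t in (0 : ℝ)..T, (φ t * e t + q t * e' t) = q T * e T - q 0 * e 0 :=
  intervalIntegral.integral_deriv_mul_eq_sub (fun t _ => hq t) (fun t _ => he t)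
    (hφ.intervalIntegrable _ _) (he'.intervalIntegrable _ _)

theorem eq_zero_of_integral_eq_zero {f : ℝ → ℝ} (hf : Continuous f) {T : ℝ} (hT : 0 < T)
    (hf0 : ∀ t, 0 ≤ f t) (h : ∫ t in (0 : ℝ)..T, f t = 0) : ∀ t ∈ Icc 0 T, f t = 0 := by
  intro t ht
  by_contra hne
  have := intervalIntegral.integral_pos hT hf.continuousOn (fun s _ => hf0 s)
    ⟨t, ht, lt_of_le_of_ne (hf0 t) (Ne.symm hne)⟩
  linarith

/-- Shooting: `y` solves the homogeneous equation and `z` the full one, both with zero initial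
slope. A multiple of `y` is subtracted from `z` to cancel the slope at `T`. -/
theorem exists_isNeumannSolution {w : ℝ → ℝ} (hw : Continuous w) (hw0 : ∀ t, 0 < w t)
    {k T : ℝ} (hk : 0 < k) (hT : 0 < T) (κ : ℝ) :
    ∃ u q φ, IsNeumannSolution w κ k T u q φ := by
  have ha : Continuous fun t => k * w t ^ 2 := by fun_prop
  obtain ⟨y, yq, yφ, hy, hyq, hyφ, hyeq, hy0, hyq0⟩ :=
    exists_solution_second_order ha (continuous_const (y := (0 : ℝ))) hT 1
  obtain ⟨z, zq, zφ, hz, hzq, hzφ, hzeq, hz0, hzq0⟩ :=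
    exists_solution_second_order ha (by fun_prop : Continuous fun t => -(k * w t * κ)) hT 0
  have hyc : Continuous y := continuous_iff_continuousAt.2 fun s => (hy s).continuousAt
  have hyqc : Continuous yq := continuous_iff_continuousAt.2 fun s => (hyq s).continuousAt
  -- If both end slopes of `y` vanished, testing its equation against `y` would give `∫ (k (w y)² +
  -- y'²) = 0`, contrary to `y 0 = 1`.
  have hne : yq T ≠ 0 := by
    intro h0
    have h1 := integral_weak_form (T := T) hyq hyφ hy hyqc
    have h2 : (∫ t in (0 : ℝ)..T, (yφ t * y t + yq t * yq t)) =
        ∫ t in (0 : ℝ)..T, (k * (w t * y t) ^ 2 + yq t ^ 2) := by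
      refine intervalIntegral.integral_congr fun t ht => ?_
      rw [uIcc_of_le hT.le] at ht
      simp only [hyeq t ht]
      ring
    rw [h2, h0, hyq0, zero_mul, zero_mul, sub_zero] at h1
    have h3 := eq_zero_of_integral_eq_zero
      (by fun_prop : Continuous fun t => k * (w t * y t) ^ 2 + yq t ^ 2) hT
      (fun t => by positivity) h1 0 ⟨le_rfl, hT.le⟩
    have := hw0 0
    simp only [hy0, mul_one] at h3
    have h4 : 0 < k * w 0 ^ 2 := by positivity
    nlinarith [sq_nonneg (yq 0)]
  set lam := zq T / yq T with hlam
  refine ⟨fun t => z t - lam * y t, fun t => zq t - lam * yq t, fun t => zφ t - lam * yφ t,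
    fun t => (hz t).sub ((hy t).const_mul lam), fun t => (hzq t).sub ((hyq t).const_mul lam),
    by fun_prop, fun t ht => ?_, ?_, ?_⟩
  · simp only [hyeq t ht, hzeq t ht]
    ring
  · simp [hzq0, hyq0]
  · simp only [hlam]
    field_simp
    ring

namespace IsNeumannSolution

variable {w u q φ : ℝ → ℝ} {κ k T : ℝ}

theorem continuous_u (h : IsNeumannSolution w κ k T u q φ) : Continuous u :=
  continuous_iff_continuousAt.2 fun s => (h.deriv_u s).continuousAt

theorem continuous_q (h : IsNeumannSolution w κ k T u q φ) : Continuous q :=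
  continuous_iff_continuousAt.2 fun s => (h.deriv_q s).continuousAt

/-- The Neumann conditions remove the boundary terms, so test functions are unrestricted at the end
points. -/
theorem weak_form (h : IsNeumannSolution w κ k T u q φ) (hT : 0 ≤ T) {e e' : ℝ → ℝ}
    (he : ∀ t, HasDerivAt e (e' t) t) (he' : Continuous e') :
    ∫ t in (0 : ℝ)..T, (k * (w t * (w t * u t - κ)) * e t + q t * e' t) = 0 := by
  have h1 := integral_weak_form (T := T) h.deriv_q h.cont he he'
  rw [h.left, h.right, zero_mul, zero_mul, sub_zero] at h1
  refine Eq.trans (intervalIntegral.integral_congr fun t ht => ?_) h1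
  rw [uIcc_of_le hT] at ht
  simp only [h.eqn t ht]

/-- The quadratic energy is expanded around its critical point `u`: the linear term is the weak form
tested with `g - u`, hence zero, and the quadratic remainder is exact. -/
theorem energy_identity (h : IsNeumannSolution w κ k T u q φ) (hw : Continuous w) (hT : 0 ≤ T)
    {g g' : ℝ → ℝ} (hg : ∀ t, HasDerivAt g (g' t) t) (hg' : Continuous g') :
    k * (∫ t in (0 : ℝ)..T, (w t * g t - κ) ^ 2) + ∫ t in (0 : ℝ)..T, g' t ^ 2 =
      k * (∫ t in (0 : ℝ)..T, (w t * u t - κ) ^ 2) + (∫ t in (0 : ℝ)..T, q t ^ 2) +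
      (k * (∫ t in (0 : ℝ)..T, (w t * (g t - u t)) ^ 2) + ∫ t in (0 : ℝ)..T, (g' t - q t) ^ 2) := by
  have hgc : Continuous g := continuous_iff_continuousAt.2 fun s => (hg s).continuousAt
  have huc := h.continuous_u
  have hqc := h.continuous_q
  have hweak := h.weak_form hT (fun t => (hg t).sub (h.deriv_u t)) (hg'.sub hqc)
  have e : ∀ {f : ℝ → ℝ}, Continuous f → IntervalIntegrable f volume 0 T :=
    fun hf => hf.intervalIntegrable _ _
  have i1 := e (by fun_prop : Continuous fun t => k * (w t * g t - κ) ^ 2)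
  have i2 := e (by fun_prop : Continuous fun t => g' t ^ 2)
  have i3 := e (by fun_prop : Continuous fun t => k * (w t * u t - κ) ^ 2)
  have i4 := e (by fun_prop : Continuous fun t => q t ^ 2)
  have i5 := e (by fun_prop : Continuous fun t => k * (w t * (g t - u t)) ^ 2)
  have i6 := e (by fun_prop : Continuous fun t => (g' t - q t) ^ 2)
  simp only [← intervalIntegral.integral_const_mul]
  rw [← intervalIntegral.integral_add i1 i2, ← intervalIntegral.integral_add i3 i4,
    ← intervalIntegral.integral_add i5 i6, ← intervalIntegral.integral_add (i3.add i4) (i5.add i6),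
    ← sub_eq_zero, ← intervalIntegral.integral_sub (i1.add i2) ((i3.add i4).add (i5.add i6))]
  refine Eq.trans (intervalIntegral.integral_congr (g := fun t => 2 *
    (k * (w t * (w t * u t - κ)) * (g t - u t) + q t * (g' t - q t))) fun t _ => ?_) ?_
  · ring
  · rw [intervalIntegral.integral_const_mul]
    exact mul_eq_zero_of_right _ hweak

/-- Comparison with the competitor `0`. -/
theorem integral_sq_le (h : IsNeumannSolution w κ k T u q φ) (hw : Continuous w) (hT : 0 ≤ T)
    (hk : 0 < k) : ∫ t in (0 : ℝ)..T, (w t * u t - κ) ^ 2 ≤ κ ^ 2 * T := by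
  have h1 := h.energy_identity hw hT (g := fun _ => 0) (g' := fun _ => 0)
    (fun t => hasDerivAt_const t 0) continuous_const
  have p1 : 0 ≤ ∫ t in (0 : ℝ)..T, q t ^ 2 :=
    intervalIntegral.integral_nonneg hT fun t _ => sq_nonneg _
  have p2 : 0 ≤ ∫ t in (0 : ℝ)..T, (w t * (0 - u t)) ^ 2 :=
    intervalIntegral.integral_nonneg hT fun t _ => sq_nonneg _
  have p3 : 0 ≤ ∫ t in (0 : ℝ)..T, (0 - q t) ^ 2 :=
    intervalIntegral.integral_nonneg hT fun t _ => sq_nonneg _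
  have e1 : (∫ t in (0 : ℝ)..T, (w t * 0 - κ) ^ 2) = κ ^ 2 * T := by
    simp [mul_comm]
  have e2 : (∫ _ in (0 : ℝ)..T, (0 : ℝ) ^ 2) = 0 := by simp
  rw [e1, e2] at h1
  have := mul_nonneg hk.le p2
  refine le_of_mul_le_mul_left ?_ hk
  linarith

/-- Lipschitz dependence on `k`. With `S = ∫ (w (u - u₂))²` and `n`, `n₂` the two integrals, adding
the energy identities tested against each other's solution gives `(k + l) S ≤ |k - l| |n - n₂|`,
while Cauchy-Schwarz gives `|n - n₂|² ≤ 4 κ² T S`. -/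
theorem abs_integral_sub_le (h : IsNeumannSolution w κ k T u q φ) (hw : Continuous w)
    (hT : 0 ≤ T) {m l : ℝ} (hm : 0 < m) (hmk : m ≤ k) (hml : m ≤ l) {u₂ q₂ φ₂ : ℝ → ℝ}
    (h₂ : IsNeumannSolution w κ l T u₂ q₂ φ₂) :
    |(∫ t in (0 : ℝ)..T, (w t * u t - κ) ^ 2) - ∫ t in (0 : ℝ)..T, (w t * u₂ t - κ) ^ 2| ≤
      4 * κ ^ 2 * T / m * |k - l| := by
  have hk : 0 < k := hm.trans_le hmk
  have hl : 0 < l := hm.trans_le hml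
  have huc := h.continuous_u
  have huc₂ := h₂.continuous_u
  have e1 := h.energy_identity hw hT h₂.deriv_u h₂.continuous_q
  have e2 := h₂.energy_identity hw hT h.deriv_u h.continuous_q
  have hn := h.integral_sq_le hw hT hk
  have hn₂ := h₂.integral_sq_le hw hT hl
  have p3 : 0 ≤ ∫ t in (0 : ℝ)..T, (q₂ t - q t) ^ 2 :=
    intervalIntegral.integral_nonneg hT fun t _ => sq_nonneg _
  have p4 : 0 ≤ ∫ t in (0 : ℝ)..T, (q t - q₂ t) ^ 2 :=
    intervalIntegral.integral_nonneg hT fun t _ => sq_nonneg _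
  have hS : (∫ t in (0 : ℝ)..T, (w t * (u₂ t - u t)) ^ 2) =
      ∫ t in (0 : ℝ)..T, (w t * (u t - u₂ t)) ^ 2 :=
    intervalIntegral.integral_congr fun t _ => by ring
  rw [hS] at e1
  have hc1 : Continuous fun t => w t * (u t - u₂ t) := by fun_prop
  have hc2 : Continuous fun t => (w t * u t - κ) + (w t * u₂ t - κ) := by fun_prop
  have hc3 : Continuous fun t => (w t * u t - κ) ^ 2 := by fun_prop
  have hc4 : Continuous fun t => (w t * u₂ t - κ) ^ 2 := by fun_prop
  have hCS := sq_integral_mul_le hc1 hc2 hT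
  have hdiff : (∫ t in (0 : ℝ)..T, w t * (u t - u₂ t) * ((w t * u t - κ) + (w t * u₂ t - κ))) =
      (∫ t in (0 : ℝ)..T, (w t * u t - κ) ^ 2) - ∫ t in (0 : ℝ)..T, (w t * u₂ t - κ) ^ 2 := by
    rw [← intervalIntegral.integral_sub (hc3.intervalIntegrable _ _) (hc4.intervalIntegrable _ _)]
    exact intervalIntegral.integral_congr fun t _ => by ring
  have hsum : (∫ t in (0 : ℝ)..T, ((w t * u t - κ) + (w t * u₂ t - κ)) ^ 2) ≤
      4 * κ ^ 2 * T := by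
    have : (∫ t in (0 : ℝ)..T, ((w t * u t - κ) + (w t * u₂ t - κ)) ^ 2) ≤
        ∫ t in (0 : ℝ)..T, (2 * (w t * u t - κ) ^ 2 + 2 * (w t * u₂ t - κ) ^ 2) :=
      intervalIntegral.integral_mono_on hT ((hc2.pow 2).intervalIntegrable _ _)
        (((hc3.const_mul 2).add (hc4.const_mul 2)).intervalIntegrable _ _)
        fun t _ => by nlinarith [sq_nonneg (w t * u t - w t * u₂ t)]
    rw [intervalIntegral.integral_add ((hc3.const_mul 2).intervalIntegrable _ _)
      ((hc4.const_mul 2).intervalIntegrable _ _), intervalIntegral.integral_const_mul,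
      intervalIntegral.integral_const_mul] at this
    linarith
  rw [hdiff] at hCS
  have hS0 : 0 ≤ ∫ t in (0 : ℝ)..T, (w t * (u t - u₂ t)) ^ 2 :=
    intervalIntegral.integral_nonneg hT fun t _ => sq_nonneg _
  generalize (∫ t in (0 : ℝ)..T, (w t * (u t - u₂ t)) ^ 2) = S at *
  generalize (∫ t in (0 : ℝ)..T, (w t * u t - κ) ^ 2) = n at *
  generalize (∫ t in (0 : ℝ)..T, (w t * u₂ t - κ) ^ 2) = n₂ at *
  have hSb : (k + l) * S ≤ |k - l| * |n - n₂| := by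
    rw [← abs_mul]
    refine le_trans ?_ (neg_le_abs _)
    nlinarith
  have hmS : m * S ≤ |k - l| * |n - n₂| := by nlinarith
  have hsq : |n - n₂| * |n - n₂| ≤ S * (4 * κ ^ 2 * T) := by
    rw [abs_mul_abs_self, ← sq]
    exact hCS.trans (mul_le_mul_of_nonneg_left hsum hS0)
  rcases (abs_nonneg (n - n₂)).eq_or_lt with h0 | h0
  · rw [← h0]; positivity
  · rw [div_mul_eq_mul_div, le_div_iff₀ hm]
    refine le_of_mul_le_mul_left ?_ h0
    have hC : 0 ≤ 4 * κ ^ 2 * T := by positivity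
    have := mul_le_mul_of_nonneg_right hmS hC
    nlinarith

/-- Testing against constants and bounding the oscillation shows that a Neumann solution with small
`k` is close to the constant `c` for which `w c - κ` is orthogonal to `w`. -/
theorem abs_sub_const_le (h : IsNeumannSolution w κ k T u q φ) (hw : Continuous w)
    (hw0 : ∀ t, 0 < w t) (hT : 0 < T) (hk : 0 < k) {c : ℝ}
    (hc : ∫ t in (0 : ℝ)..T, w t * (w t * c - κ) = 0) :
    ∀ t ∈ Icc 0 T, |u t - c| ≤ √(T * (k * ∫ t in (0 : ℝ)..T, (w t * c - κ) ^ 2)) := by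
  have huc := h.continuous_u
  have hqc := h.continuous_q
  -- A constant competitor has no Dirichlet energy, so `∫ q²` is of order `k`.
  have hen := h.energy_identity hw hT.le (g := fun _ => c) (g' := fun _ => 0)
    (fun t => hasDerivAt_const t c) continuous_const
  have p1 : 0 ≤ ∫ t in (0 : ℝ)..T, (w t * u t - κ) ^ 2 :=
    intervalIntegral.integral_nonneg hT.le fun t _ => sq_nonneg _
  have p2 : 0 ≤ ∫ t in (0 : ℝ)..T, (w t * (c - u t)) ^ 2 :=
    intervalIntegral.integral_nonneg hT.le fun t _ => sq_nonneg _
  have p3 : 0 ≤ ∫ t in (0 : ℝ)..T, (0 - q t) ^ 2 :=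
    intervalIntegral.integral_nonneg hT.le fun t _ => sq_nonneg _
  have e2 : (∫ _ in (0 : ℝ)..T, (0 : ℝ) ^ 2) = 0 := by simp
  have hq2 : (∫ t in (0 : ℝ)..T, q t ^ 2) ≤ k * ∫ t in (0 : ℝ)..T, (w t * c - κ) ^ 2 := by
    rw [e2] at hen
    have := mul_nonneg hk.le p1
    have := mul_nonneg hk.le p2
    linarith
  set δ := √(T * (k * ∫ t in (0 : ℝ)..T, (w t * c - κ) ^ 2)) with hδ
  have habs : (∫ t in (0 : ℝ)..T, |q t|) ≤ δ := by
    have hcs := sq_integral_mul_le (continuous_const (y := (1 : ℝ))) hqc.abs hT.le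
    simp only [one_mul, one_pow, sq_abs, intervalIntegral.integral_const, sub_zero, smul_eq_mul,
      mul_one] at hcs
    exact Real.le_sqrt_of_sq_le (hcs.trans (mul_le_mul_of_nonneg_left hq2 hT.le))
  have hosc : ∀ s ∈ Icc 0 T, ∀ t ∈ Icc 0 T, |u t - u s| ≤ δ := by
    intro s hs t ht
    rw [← intervalIntegral.integral_eq_sub_of_hasDerivAt (fun x _ => h.deriv_u x)
      (hqc.intervalIntegrable s t), ← Real.norm_eq_abs]
    refine intervalIntegral.norm_integral_le_abs_integral_norm.trans (le_trans ?_ habs)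
    have hsub : uIcc s t ⊆ uIcc 0 T := by
      rw [uIcc_of_le hT.le]; exact uIcc_subset_Icc hs ht
    refine (intervalIntegral.abs_integral_mono_interval (uIoc_subset_uIoc_of_uIcc_subset_uIcc hsub)
      (Eventually.of_forall fun x => norm_nonneg (q x)) (hqc.norm.intervalIntegrable _ _)).trans ?_
    rw [abs_of_nonneg (intervalIntegral.integral_nonneg hT.le fun x _ => norm_nonneg _)]
    rfl
  have hweak := h.weak_form hT.le (e := fun _ => 1) (e' := fun _ => 0)
    (fun t => hasDerivAt_const t 1) continuous_const
  simp only [mul_one, mul_zero, add_zero] at hweak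
  rw [intervalIntegral.integral_const_mul] at hweak
  have hweak2 := (mul_eq_zero.1 hweak).resolve_left hk.ne'
  intro t ht
  have hcA : Continuous fun s => w s * (w s * u s - κ) := by fun_prop
  have hcB : Continuous fun s => w s * (w s * c - κ) := by fun_prop
  have hcW : Continuous fun s => w s ^ 2 := by fun_prop
  have hW0 : 0 < ∫ s in (0 : ℝ)..T, w s ^ 2 :=
    intervalIntegral.integral_pos hT hcW.continuousOn (fun s _ => sq_nonneg _)
      ⟨0, ⟨le_rfl, hT.le⟩, by have := hw0 0; positivity⟩
  -- The equation tested against `1` and the choice of `c` give `∫ w² u = κ ∫ w = c ∫ w²`. Thus `c`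
  -- is a weighted mean of `u`, and `u t - c` is bounded by the oscillation.
  have hid : (u t - c) * (∫ s in (0 : ℝ)..T, w s ^ 2) =
      ∫ s in (0 : ℝ)..T, w s ^ 2 * (u t - u s) := by
    have : (∫ s in (0 : ℝ)..T, w s ^ 2 * (u t - u s)) =
        ∫ s in (0 : ℝ)..T, ((u t - c) * w s ^ 2 -
          (w s * (w s * u s - κ) - w s * (w s * c - κ))) :=
      intervalIntegral.integral_congr fun s _ => by ring
    have hcAB : Continuous fun s => w s * (w s * u s - κ) - w s * (w s * c - κ) := hcA.sub hcB
    rw [this, intervalIntegral.integral_sub ((hcW.const_mul _).intervalIntegrable _ _)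
      (hcAB.intervalIntegrable _ _),
      intervalIntegral.integral_sub (hcA.intervalIntegrable _ _) (hcB.intervalIntegrable _ _),
      hweak2, hc, intervalIntegral.integral_const_mul]
    ring
  refine le_of_mul_le_mul_right ?_ hW0
  rw [← abs_of_pos hW0, ← abs_mul, hid, abs_of_pos hW0, ← intervalIntegral.integral_const_mul]
  refine (intervalIntegral.abs_integral_le_integral_abs hT.le).trans ?_
  have hcC : Continuous fun s => |w s ^ 2 * (u t - u s)| := by fun_prop
  refine intervalIntegral.integral_mono_on hT.le (hcC.intervalIntegrable _ _)
    ((hcW.const_mul _).intervalIntegrable _ _) fun s hs => ?_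
  rw [abs_mul, abs_of_nonneg (sq_nonneg (w s)), mul_comm]
  exact mul_le_mul_of_nonneg_right (hosc s hs t ht) (sq_nonneg _)

end IsNeumannSolution

/-- Self-consistent Neumann solution: the Euler-Lagrange equation of the exponential functional
`exp (B / 2 * ∫ (w u - κ)²)` plus a Dirichlet energy. -/
theorem exists_isNeumannSolution_selfConsistent {w : ℝ → ℝ} (hw : Continuous w)
    (hw0 : ∀ t, 0 < w t) {T a B : ℝ} (hT : 0 < T) (ha : 0 < a) (hB : 0 < B) (κ : ℝ) :
    ∃ k u q φ, 0 < k ∧ k ≤ a * Real.exp (B / 2 * (κ ^ 2 * T)) ∧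
      k = a * Real.exp (B / 2 * ∫ t in (0 : ℝ)..T, (w t * u t - κ) ^ 2) ∧
      IsNeumannSolution w κ k T u q φ := by
  have hex : ∀ k : ℝ, 0 < k → ∃ u q φ, IsNeumannSolution w κ k T u q φ :=
    fun k hk => exists_isNeumannSolution hw hw0 hk hT κ
  -- Any choice of solutions will do: the Lipschitz estimate holds for arbitrary ones.
  choose! U Q Φ hU using hex
  let n : ℝ → ℝ := fun k => ∫ t in (0 : ℝ)..T, (w t * U k t - κ) ^ 2
  have hn0 : ∀ k, 0 ≤ n k := fun k =>
    intervalIntegral.integral_nonneg hT.le fun t _ => sq_nonneg _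
  have hn1 : ∀ k, 0 < k → n k ≤ κ ^ 2 * T := fun k hk => (hU k hk).integral_sq_le hw hT.le hk
  set M := a * Real.exp (B / 2 * (κ ^ 2 * T)) with hM
  have haM : a ≤ M := le_mul_of_one_le_right ha.le (Real.one_le_exp (by positivity))
  have hcont : ContinuousOn n (Icc a M) := by
    have : LipschitzOnWith (Real.toNNReal (4 * κ ^ 2 * T / a)) n (Icc a M) :=
      LipschitzOnWith.of_dist_le_mul fun k hk l hl => by
        rw [Real.coe_toNNReal _ (by positivity), Real.dist_eq, Real.dist_eq]
        exact (hU k (ha.trans_le hk.1)).abs_integral_sub_le hw hT.le ha hk.1 hl.1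
          (hU l (ha.trans_le hl.1))
    exact this.continuousOn
  have hcont2 : ContinuousOn (fun k => k - a * Real.exp (B / 2 * n k)) (Icc a M) := by
    fun_prop
  -- Signs at the two ends: the exponential is at least `1` at `a`, and `n M ≤ κ ^ 2 * T` at `M`.
  have hmem : (0 : ℝ) ∈ Icc (a - a * Real.exp (B / 2 * n a)) (M - a * Real.exp (B / 2 * n M)) := by
    constructor
    · have : 1 ≤ Real.exp (B / 2 * n a) := Real.one_le_exp (mul_nonneg (by positivity) (hn0 a))
      nlinarith
    · have := hn1 M (ha.trans_le haM)
      rw [sub_nonneg, hM]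
      gcongr
  obtain ⟨k, hk, hk0⟩ := intermediate_value_Icc haM hcont2 hmem
  have hkp : 0 < k := ha.trans_le hk.1
  exact ⟨k, U k, Q k, Φ k, hkp, hk.2, sub_eq_zero.1 hk0, hU k hkp⟩

/-- A self-consistent Neumann solution minimizes the exponential functional, with a quadratic
gap. -/
theorem IsNeumannSolution.functional_gap {w u q φ : ℝ → ℝ} {κ k T B C θ : ℝ}
    (h : IsNeumannSolution w κ k T u q φ) (hw : Continuous w) (hT : 0 ≤ T) (hC : 0 < C)
    (hk : θ * k = C * B * Real.exp (B / 2 * ∫ t in (0 : ℝ)..T, (w t * u t - κ) ^ 2))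
    (hθ : 0 < θ) {g g' : ℝ → ℝ} (hg : ∀ t, HasDerivAt g (g' t) t) (hg' : Continuous g') :
    C * Real.exp (B / 2 * ∫ t in (0 : ℝ)..T, (w t * u t - κ) ^ 2) +
      θ / 2 * (∫ t in (0 : ℝ)..T, q t ^ 2) +
      θ / 2 * (k * ∫ t in (0 : ℝ)..T, (w t * (g t - u t)) ^ 2) ≤
    C * Real.exp (B / 2 * ∫ t in (0 : ℝ)..T, (w t * g t - κ) ^ 2) +
      θ / 2 * (∫ t in (0 : ℝ)..T, g' t ^ 2) := by
  have hen := h.energy_identity hw hT hg hg'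
  have p3 : 0 ≤ ∫ t in (0 : ℝ)..T, (g' t - q t) ^ 2 :=
    intervalIntegral.integral_nonneg hT fun t _ => sq_nonneg _
  generalize (∫ t in (0 : ℝ)..T, (w t * g t - κ) ^ 2) = N at *
  generalize (∫ t in (0 : ℝ)..T, (w t * u t - κ) ^ 2) = n at *
  -- Tangent line of `exp` at `B / 2 * n`; by `hk`, `C` times its slope in `N` is `θ * k / 2`, the
  -- coefficient in the energy identity scaled by `θ / 2`.
  have hexp : Real.exp (B / 2 * n) * (1 + (B / 2 * N - B / 2 * n)) ≤ Real.exp (B / 2 * N) := by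
    have h1 := Real.add_one_le_exp (B / 2 * N - B / 2 * n)
    have h2 : Real.exp (B / 2 * N) = Real.exp (B / 2 * n) * Real.exp (B / 2 * N - B / 2 * n) := by
      rw [← Real.exp_add]; ring_nf
    rw [h2]
    exact mul_le_mul_of_nonneg_left (by linarith) (Real.exp_pos _).le
  have h3 := mul_le_mul_of_nonneg_left hexp hC.le
  have h4 : C * (Real.exp (B / 2 * n) * (1 + (B / 2 * N - B / 2 * n))) =
      C * Real.exp (B / 2 * n) + θ * k / 2 * (N - n) := by
    rw [hk]; ring
  have h5 := mul_nonneg hθ.le p3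
  have h6 := congrArg (fun z => θ / 2 * z) hen
  nlinarith

/-! ### The objective as a functional of the deviation from the expert's decision -/

theorem hasDerivAt_rationalDecision (r v σ T α t : ℝ) :
    HasDerivAt (rationalDecision r v σ T α) (r * rationalDecision r v σ T α t) t := by
  have h1 : HasDerivAt (fun s : ℝ => Real.exp (r * (s - T)))
      (Real.exp (r * (t - T)) * (r * 1)) t :=
    (((hasDerivAt_id t).sub_const T).const_mul r).exp
  refine (h1.const_mul (v / (α * σ ^ 2))).congr_deriv ?_
  simp only [rationalDecision]
  ring

theorem exp_mul_rationalDecision (r v σ T α t : ℝ) :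
    Real.exp (r * (T - t)) * rationalDecision r v σ T α t = v / (α * σ ^ 2) := by
  have : Real.exp (r * (T - t)) * Real.exp (r * (t - T)) = 1 := by
    rw [← Real.exp_add, show r * (T - t) + r * (t - T) = 0 by ring, Real.exp_zero]
  rw [rationalDecision, mul_left_comm, this, mul_one]

/-- Completing the square in `w p` about `v / (α₁ σ²)`; the offset from the expert's constant `v /
(α₂ σ²)` is `κ`. -/
theorem integral_exponent_eq {σ α₁ α₂ v : ℝ} (hσ : 0 < σ) (hα₁ : 0 < α₁)
    {w u p : ℝ → ℝ} (hw : Continuous w) (hp : Continuous p) {T : ℝ}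
    (hwp : ∀ t, w t * p t = v / (α₂ * σ ^ 2) + w t * u t) (e : ℝ) :
    -α₁ * (e + v * ∫ t in (0 : ℝ)..T, w t * p t) +
      α₁ ^ 2 / 2 * (∫ t in (0 : ℝ)..T, (σ * (w t * p t)) ^ 2) =
    (-α₁ * e - v ^ 2 / (2 * σ ^ 2) * T) + α₁ ^ 2 * σ ^ 2 / 2 *
      ∫ t in (0 : ℝ)..T, (w t * u t - v * (α₁⁻¹ - α₂⁻¹) / σ ^ 2) ^ 2 := by
  have hcl : Continuous fun t => w t * p t := by fun_prop
  have hcq : Continuous fun t => (σ * (w t * p t)) ^ 2 := by fun_prop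
  have key : (∫ t in (0 : ℝ)..T, (w t * u t - v * (α₁⁻¹ - α₂⁻¹) / σ ^ 2) ^ 2) =
      ∫ t in (0 : ℝ)..T, ((1 / σ ^ 2) * (σ * (w t * p t)) ^ 2 -
        (2 * v / (α₁ * σ ^ 2)) * (w t * p t) + v ^ 2 / (α₁ ^ 2 * σ ^ 4)) := by
    refine intervalIntegral.integral_congr fun t _ => ?_
    have hwu : w t * u t = w t * p t - v / (α₂ * σ ^ 2) := by rw [hwp]; ring
    simp only [hwu, mul_inv, div_eq_mul_inv]
    field_simp
    ring
  have i1 : IntervalIntegrable (fun t => (1 / σ ^ 2) * (σ * (w t * p t)) ^ 2) volume 0 T :=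
    (hcq.const_mul _).intervalIntegrable _ _
  have i2 : IntervalIntegrable (fun t => (2 * v / (α₁ * σ ^ 2)) * (w t * p t)) volume 0 T :=
    (hcl.const_mul _).intervalIntegrable _ _
  rw [key, intervalIntegral.integral_add (i1.sub i2) intervalIntegrable_const,
    intervalIntegral.integral_sub i1 i2, intervalIntegral.integral_const_mul,
    intervalIntegral.integral_const_mul, intervalIntegral.integral_const]
  simp only [smul_eq_mul, sub_zero]
  field_simp
  ring

/-- The multiplicative constant in the expected disutility. -/
def disutilityConst (r v σ T α x : ℝ) : ℝ :=
  1 / α * Real.exp (-α * (Real.exp (r * T) * x) - v ^ 2 / (2 * σ ^ 2) * T)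

section Objective

variable {Ω : Type*} [MeasurableSpace Ω] {μ : Measure Ω} {W : NNReal → Ω → ℝ}
  {r v σ T α₁ α₂ x₁ θ : ℝ}

/-- The choice of `X` is immaterial because its terminal value is determined almost everywhere, so
the objective is a functional of the deviation alone. -/
theorem objective_eq (hW : IsBrownianReal W μ) (hσ : 0 < σ) (hT : 0 < T) (hα₁ : 0 < α₁)
    {P u u' : ℝ → ℝ} {X : ℝ → Ω → ℝ} (hu' : Continuous u') (hu : ∀ t, HasDerivAt u (u' t) t)
    (hP : EqOn P (fun t => rationalDecision r v σ T α₂ t + u t) (Icc 0 T))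
    (hX : IsWealthProcess μ W r v σ T x₁ P X) :
    objective μ r v σ T α₁ α₂ θ P X =
      -(disutilityConst r v σ T α₁ x₁ * Real.exp (α₁ ^ 2 * σ ^ 2 / 2 * ∫ t in (0 : ℝ)..T,
          (Real.exp (r * (T - t)) * u t - v * (α₁⁻¹ - α₂⁻¹) / σ ^ 2) ^ 2) +
        θ / 2 * ∫ t in (0 : ℝ)..T, u' t ^ 2) := by
  have hb := hasDerivAt_rationalDecision r v σ T α₂
  have hbc : Continuous (rationalDecision r v σ T α₂) :=
    continuous_iff_continuousAt.2 fun s => (hb s).continuousAt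
  have huc : Continuous u := continuous_iff_continuousAt.2 fun s => (hu s).continuousAt
  have hp : ∀ t, HasDerivAt (fun t => rationalDecision r v σ T α₂ t + u t)
      (r * rationalDecision r v σ T α₂ t + u' t) t := fun t => (hb t).add (hu t)
  have hp' : Continuous fun t => r * rationalDecision r v σ T α₂ t + u' t := by fun_prop
  have hdisp : integralDisparity T (changingRate T P)
      (changingRate T (rationalDecision r v σ T α₂)) =
      1 / 2 * ∫ t in (0 : ℝ)..T, u' t ^ 2 := by
    unfold integralDisparity
    congr 1
    refine intervalIntegral.integral_congr fun t ht => ?_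
    rw [uIcc_of_le hT.le] at ht
    simp only [changingRate_eq hT hp hP ht, changingRate_eq hT hb (fun _ _ => rfl) ht]
    ring
  have hutil : (∫ ω, utility α₁ (X T ω) ∂μ) = ∫ ω, utility α₁ (wealth W r v σ x₁
      (fun t => rationalDecision r v σ T α₂ t + u t)
      (fun t => r * rationalDecision r v σ T α₂ t + u' t) T ω) ∂μ := by
    refine integral_congr_ae ?_
    filter_upwards [hX.ae_eq_wealth hW hT hp' hp hP] with ω hω
    rw [hω]
  have hexp := integral_exponent_eq (α₂ := α₂) (v := v) (T := T) (u := u)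
    (p := fun t => rationalDecision r v σ T α₂ t + u t) hσ hα₁
    (by fun_prop : Continuous fun t => Real.exp (r * (T - t))) (by fun_prop)
    (fun t => by rw [mul_add, exp_mul_rationalDecision]) (Real.exp (r * T) * x₁)
  rw [objective, hdisp, hutil, integral_utility_wealth hW hT hp' hp, hexp, Real.exp_add,
    disutilityConst]
  ring

theorem isFeasible_wealth (hW : IsBrownianReal W μ) (hT : 0 < T)
    {u u' : ℝ → ℝ} (hu' : Continuous u') (hu : ∀ t, HasDerivAt u (u' t) t)
    (h0 : u' 0 = 0) (h1 : u' T = 0) :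
    IsFeasible μ W r v σ T α₂ x₁ (fun t => rationalDecision r v σ T α₂ t + u t)
      (wealth W r v σ x₁ (fun t => rationalDecision r v σ T α₂ t + u t)
        (fun t => r * rationalDecision r v σ T α₂ t + u' t)) := by
  have hb := hasDerivAt_rationalDecision r v σ T α₂
  have hbc : Continuous (rationalDecision r v σ T α₂) :=
    continuous_iff_continuousAt.2 fun s => (hb s).continuousAt
  have hp : ∀ t, HasDerivAt (fun t => rationalDecision r v σ T α₂ t + u t)
      (r * rationalDecision r v σ T α₂ t + u' t) t := fun t => (hb t).add (hu t)
  have hp' : Continuous fun t => r * rationalDecision r v σ T α₂ t + u' t := by fun_prop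
  refine ⟨ContDiff.contDiffOn ?_, ?_, ?_, isWealthProcess_wealth hW hp' hp fun _ _ => rfl⟩
  · rw [contDiff_one_iff_deriv]
    refine ⟨fun t => (hp t).differentiableAt, ?_⟩
    rwa [funext fun t => (hp t).deriv]
  · rw [changingRate_eq hT hp (fun _ _ => rfl) ⟨le_rfl, hT.le⟩]
    simp only [h0, rationalDecision]
    ring_nf
  · rw [changingRate_eq hT hp (fun _ _ => rfl) ⟨hT.le, le_rfl⟩]
    simp only [h1, rationalDecision, sub_self, mul_zero, Real.exp_zero]
    ring

/-- Every feasible decision is a continuously differentiable deviation from the expert's one. -/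
theorem IsFeasible.exists_deviation (hT : 0 < T) {P : ℝ → ℝ} {X : ℝ → Ω → ℝ}
    (h : IsFeasible μ W r v σ T α₂ x₁ P X) :
    ∃ u u' : ℝ → ℝ, Continuous u' ∧ (∀ t, HasDerivAt u (u' t) t) ∧
      EqOn P (fun t => rationalDecision r v σ T α₂ t + u t) (Icc 0 T) := by
  obtain ⟨p, p', hp', hp, hpP, -⟩ := exists_extension_of_contDiffOn hT h.contDiffOn
  have hb := hasDerivAt_rationalDecision r v σ T α₂
  have hbc : Continuous (rationalDecision r v σ T α₂) :=
    continuous_iff_continuousAt.2 fun s => (hb s).continuousAt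
  refine ⟨fun t => p t - rationalDecision r v σ T α₂ t,
    fun t => p' t - r * rationalDecision r v σ T α₂ t, by fun_prop,
    fun t => (hp t).sub (hb t), fun t ht => ?_⟩
  simp only [← hpP ht]
  ring

/-- The bound on `k` is a constant over `θ`, which is what makes the limit `θ → ∞` work. -/
theorem exists_optimal_deviation (hW : IsBrownianReal W μ) (hσ : 0 < σ) (hT : 0 < T)
    (hα₁ : 0 < α₁) (hθ : 0 < θ) :
    ∃ k u q φ, 0 < k ∧
      k ≤ disutilityConst r v σ T α₁ x₁ * (α₁ ^ 2 * σ ^ 2) / θ *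
        Real.exp (α₁ ^ 2 * σ ^ 2 / 2 * ((v * (α₁⁻¹ - α₂⁻¹) / σ ^ 2) ^ 2 * T)) ∧
      IsNeumannSolution (fun t => Real.exp (r * (T - t))) (v * (α₁⁻¹ - α₂⁻¹) / σ ^ 2) k T u q φ ∧
      IsOptimalDecision μ W r v σ T α₁ α₂ x₁ θ (fun t => rationalDecision r v σ T α₂ t + u t) ∧
      ∀ Q, IsOptimalDecision μ W r v σ T α₁ α₂ x₁ θ Q →
        EqOn Q (fun t => rationalDecision r v σ T α₂ t + u t) (Icc 0 T) := by
  have hw : Continuous fun t => Real.exp (r * (T - t)) := by fun_prop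
  have hC : 0 < disutilityConst r v σ T α₁ x₁ := by
    unfold disutilityConst; positivity
  have hB : 0 < α₁ ^ 2 * σ ^ 2 := by positivity
  obtain ⟨k, u, q, φ, hk, hkle, hkeq, hN⟩ := exists_isNeumannSolution_selfConsistent hw
    (fun t => Real.exp_pos _) hT
    (by positivity : 0 < disutilityConst r v σ T α₁ x₁ * (α₁ ^ 2 * σ ^ 2) / θ) hB
    (v * (α₁⁻¹ - α₂⁻¹) / σ ^ 2)
  have hθk : θ * k = disutilityConst r v σ T α₁ x₁ * (α₁ ^ 2 * σ ^ 2) *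
      Real.exp (α₁ ^ 2 * σ ^ 2 / 2 * ∫ t in (0 : ℝ)..T,
        (Real.exp (r * (T - t)) * u t - v * (α₁⁻¹ - α₂⁻¹) / σ ^ 2) ^ 2) := by
    calc θ * k = θ * (disutilityConst r v σ T α₁ x₁ * (α₁ ^ 2 * σ ^ 2) / θ * _) :=
          congrArg (θ * ·) hkeq
      _ = _ := by field_simp
  have hfeas := isFeasible_wealth (r := r) (v := v) (σ := σ) (α₂ := α₂) (x₁ := x₁) hW hT
    hN.continuous_q hN.deriv_u hN.left hN.right
  have hobj := objective_eq (α₁ := α₁) (θ := θ) hW hσ hT hα₁ hN.continuous_q hN.deriv_u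
    (fun _ _ => rfl) hfeas.wealth
  -- One inequality serves twice: dropping the gap gives optimality, and for a second optimum the
  -- gap must vanish.
  have hgap : ∀ (Q : ℝ → ℝ) (Y : ℝ → Ω → ℝ), IsFeasible μ W r v σ T α₂ x₁ Q Y →
      ∃ g : ℝ → ℝ, Continuous g ∧
        EqOn Q (fun t => rationalDecision r v σ T α₂ t + g t) (Icc 0 T) ∧
        objective μ r v σ T α₁ α₂ θ Q Y +
          θ / 2 * (k * ∫ t in (0 : ℝ)..T, (Real.exp (r * (T - t)) * (g t - u t)) ^ 2) ≤
        objective μ r v σ T α₁ α₂ θ (fun t => rationalDecision r v σ T α₂ t + u t)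
          (wealth W r v σ x₁ (fun t => rationalDecision r v σ T α₂ t + u t)
            (fun t => r * rationalDecision r v σ T α₂ t + q t)) := by
    intro Q Y hQ
    obtain ⟨g, g', hg', hg, hQg⟩ := hQ.exists_deviation hT
    refine ⟨g, continuous_iff_continuousAt.2 fun s => (hg s).continuousAt, hQg, ?_⟩
    have h1 := hN.functional_gap hw hT.le hC hθk hθ hg hg'
    rw [hobj, objective_eq hW hσ hT hα₁ hg' hg hQg hQ.wealth]
    linarith
  refine ⟨k, u, q, φ, hk, hkle, hN, ⟨_, hfeas, fun Q Y hQ => ?_⟩, fun Q ⟨Y, hQ, hQopt⟩ => ?_⟩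
  · obtain ⟨g, -, -, hle⟩ := hgap Q Y hQ
    have : 0 ≤ ∫ t in (0 : ℝ)..T, (Real.exp (r * (T - t)) * (g t - u t)) ^ 2 :=
      intervalIntegral.integral_nonneg hT.le fun t _ => sq_nonneg _
    have : 0 ≤ θ / 2 * (k * ∫ t in (0 : ℝ)..T, (Real.exp (r * (T - t)) * (g t - u t)) ^ 2) := by
      positivity
    linarith
  · obtain ⟨g, hgc, hQg, hle⟩ := hgap Q Y hQ
    have hle2 := hQopt _ _ hfeas
    have huc := hN.continuous_u
    have h0 : 0 ≤ ∫ t in (0 : ℝ)..T, (Real.exp (r * (T - t)) * (g t - u t)) ^ 2 :=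
      intervalIntegral.integral_nonneg hT.le fun t _ => sq_nonneg _
    have h1 : (∫ t in (0 : ℝ)..T, (Real.exp (r * (T - t)) * (g t - u t)) ^ 2) = 0 := by
      refine le_antisymm (le_of_mul_le_mul_left ?_ (by positivity : 0 < θ / 2 * k)) h0
      linarith
    intro t ht
    have h2 := eq_zero_of_integral_eq_zero (by fun_prop) hT (fun t => sq_nonneg _) h1 t ht
    have h3 := (mul_eq_zero.1 (pow_eq_zero_iff two_ne_zero |>.1 h2)).resolve_left
      (Real.exp_pos _).ne'
    rw [hQg ht]
    simp only
    linarith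

end Objective

/-! ### The limiting constant and convergence as `θ → ∞`. -/

/-- The constant is `κ ∫ w / ∫ w²`, where `∫ w = (exp (r T) - 1) / r` and `∫ w² = (exp (2 r T) - 1)
/ (2 r)`; hence the factor `2`. -/
theorem integral_exp_mul_sub_eq_zero {r T : ℝ} (hr : r ≠ 0) (hT : 0 < T) (κ : ℝ) :
    ∫ t in (0 : ℝ)..T, Real.exp (r * (T - t)) * (Real.exp (r * (T - t)) *
      (2 * κ * ((Real.exp (r * T) - 1) / (Real.exp (2 * r * T) - 1))) - κ) = 0 := by
  set c := 2 * κ * ((Real.exp (r * T) - 1) / (Real.exp (2 * r * T) - 1)) with hc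
  have hne : Real.exp (2 * r * T) - 1 ≠ 0 := by
    rw [sub_ne_zero, Ne, Real.exp_eq_one_iff]
    positivity
  have hd : ∀ t : ℝ, HasDerivAt (fun t => κ / r * Real.exp (r * (T - t)) -
      c / (2 * r) * Real.exp (r * (T - t)) ^ 2)
      (Real.exp (r * (T - t)) * (Real.exp (r * (T - t)) * c - κ)) t := by
    intro t
    have h1 : HasDerivAt (fun s : ℝ => Real.exp (r * (T - s)))
        (Real.exp (r * (T - t)) * (r * (-1))) t :=
      (((hasDerivAt_id t).const_sub T).const_mul r).exp
    refine ((h1.const_mul (κ / r)).sub ((h1.pow 2).const_mul (c / (2 * r)))).congr_deriv ?_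
    push_cast
    field_simp
    ring
  rw [intervalIntegral.integral_eq_sub_of_hasDerivAt (fun t _ => hd t)
    ((by fun_prop : Continuous fun t => Real.exp (r * (T - t)) *
      (Real.exp (r * (T - t)) * c - κ)).intervalIntegrable _ _)]
  have he : Real.exp (r * T) ^ 2 = Real.exp (2 * r * T) := by
    rw [← Real.exp_nat_mul]; congr 1; push_cast; ring
  simp only [sub_self, mul_zero, Real.exp_zero, sub_zero, one_pow, mul_one, he]
  have hcm : c * (Real.exp (2 * r * T) - 1) = 2 * κ * (Real.exp (r * T) - 1) := by
    rw [hc]; field_simp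
  generalize Real.exp (2 * r * T) = Y at hcm ⊢
  generalize Real.exp (r * T) = X at hcm ⊢
  field_simp
  linarith

end Imitation

end

theorem theorem6 {Ω : Type*} [MeasurableSpace Ω] (μ : Measure Ω) (W : NNReal → Ω → ℝ)
    (hW : IsBrownianReal W μ) (r v σ T α₁ α₂ x₁ : ℝ) (hr : r ≠ 0) (hσ : 0 < σ) (hT : 0 < T)
    (hα₁ : 0 < α₁) (hα₂ : 0 < α₂) :
    (∀ θ : ℝ, 0 < θ →
      ∃ P : ℝ → ℝ, Imitation.IsOptimalDecision μ W r v σ T α₁ α₂ x₁ θ P ∧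
        ∀ Q : ℝ → ℝ, Imitation.IsOptimalDecision μ W r v σ T α₁ α₂ x₁ θ Q →
          EqOn Q P (Icc 0 T)) ∧
    ∀ P : ℝ → ℝ → ℝ,
      (∀ θ : ℝ, 0 < θ → Imitation.IsOptimalDecision μ W r v σ T α₁ α₂ x₁ θ (P θ)) →
      TendstoUniformlyOn P
        (fun t => Imitation.rationalDecision r v σ T α₂ t +
          2 * v * (α₁⁻¹ - α₂⁻¹) / σ ^ 2 *
            ((Real.exp (r * T) - 1) / (Real.exp (2 * r * T) - 1)))
        atTop (Icc 0 T) := by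
  constructor
  · intro θ hθ
    obtain ⟨k, u, q, φ, -, -, -, hopt, huniq⟩ :=
      Imitation.exists_optimal_deviation (r := r) (v := v) (α₂ := α₂) (x₁ := x₁) hW hσ hT hα₁ hθ
    exact ⟨_, hopt, huniq⟩
  · intro P hP
    set κ := v * (α₁⁻¹ - α₂⁻¹) / σ ^ 2 with hκ
    set c := 2 * κ * ((Real.exp (r * T) - 1) / (Real.exp (2 * r * T) - 1)) with hc
    have hcint := Imitation.integral_exp_mul_sub_eq_zero hr hT κ
    set N := ∫ t in (0 : ℝ)..T, (Real.exp (r * (T - t)) * c - κ) ^ 2 with hN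
    have hN0 : 0 ≤ N := intervalIntegral.integral_nonneg hT.le fun t _ => sq_nonneg _
    set A := Imitation.disutilityConst r v σ T α₁ x₁ * (α₁ ^ 2 * σ ^ 2) with hA
    set E := Real.exp (α₁ ^ 2 * σ ^ 2 / 2 * (κ ^ 2 * T)) with hE
    -- This is the estimate of `abs_sub_const_le` with `k` replaced by its upper bound `A / θ * E`;
    -- it does not depend on `t`, so convergence is uniform.
    have hlim : Tendsto (fun θ : ℝ => √(T * (A / θ * E * N))) atTop (𝓝 0) := by
      have h1 : Tendsto (fun θ : ℝ => A / θ) atTop (𝓝 0) := tendsto_const_nhds.div_atTop tendsto_id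
      have h2 := (((h1.mul_const E).mul_const N).const_mul T).sqrt
      simpa using h2
    rw [Metric.tendstoUniformlyOn_iff]
    intro ε hε
    filter_upwards [hlim.eventually_lt_const hε, eventually_gt_atTop 0] with θ hθε hθ t ht
    obtain ⟨k, u, q, φ, hk, hkle, hNeu, -, huniq⟩ :=
      Imitation.exists_optimal_deviation (r := r) (v := v) (α₂ := α₂) (x₁ := x₁) hW hσ hT hα₁ hθ
    have h1 := hNeu.abs_sub_const_le (by fun_prop) (fun t => Real.exp_pos _) hT hk hcint t ht
    rw [huniq (P θ) (hP θ hθ) ht, dist_comm, Real.dist_eq]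
    refine lt_of_le_of_lt ?_ hθε
    have h2 : Imitation.rationalDecision r v σ T α₂ t + u t -
        (Imitation.rationalDecision r v σ T α₂ t + 2 * v * (α₁⁻¹ - α₂⁻¹) / σ ^ 2 *
          ((Real.exp (r * T) - 1) / (Real.exp (2 * r * T) - 1))) = u t - c := by
      rw [hc, hκ]; ring
    rw [h2]
    refine h1.trans (Real.sqrt_le_sqrt ?_)
    gcongr
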